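/- **Conventions.** Strings are binary. A relation $R\subseteq\{0,1\}^*\times\{0,1\}^*$ is an FNP relation if it is recognizable in polynomial time and polynomially bounded, i.e. $(x,y)\in R$ implies $|y|\le p(|x|)$ for some polynomial $p$. NP is the class of languages $\{x : \exists y\,(x,y)\in R\}$ with $R$ an FNP relation, and coNP consists of the complements of the languages in NP. In the search problem $\Lambda_R$ a valid answer to $x$ is a string $y$ with $(x,y)\in R$, or the reject symbol $\bot$ if no such $y$ exists. In a search problem with a promise, every answer is valid on an input that violates the promise; such a problem is in FNP if it has the same valid answers on its promise as $\Lambda_R$ for some FNP relation $R$; it is solvable in polynomial time if some polynomial-time algorithm always outputs a valid answer. A (generalized many-one) reduction from $\Lambda_1$ to $\Lambda_2$ is a pair $(\alpha,\beta)$ of polynomial-time computable functions such that, whenever $z$ (a string or $\bot$) is a valid answer to $\alpha(x)$ in $\Lambda_2$, then $\beta(x,z)$ is a valid answer to $x$ in $\Lambda_1$; many-one reductions are those in which moreover $\beta(x,z)=\bot$ if and only if $z=\bot$. A problem is FNP-hard if $\Lambda_R$ reduces to it for every FNP relation $R$, and FNP-intermediate if it is in FNP, not solvable in polynomial time, and not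 FNP-hard. Let $A,B$ be finite relational structures over the same finite signature such that there is a homomorphism $A\to B$ (a finite template). $\mathrm{PCSP}(A,B)$ is the promise problem of accepting a given finite structure $I$ if $I\to A$ and rejecting it if $I\not\to B$; it is solvable in polynomial time if some polynomial-time algorithm does so. $\mathrm{sPCSP}(A,B)$ is the search problem of finding a homomorphism $I\to B$, or rejecting $I$ if there is none, under the promise that $I\to A$ or $I\not\to B$. **Theorem.** Let $(A,B)$ be a finite template for which $\mathrm{PCSP}(A,B)$ is solvable in polynomial time, and suppose $\mathrm{NP}\neq\mathrm{coNP}$. Then $\mathrm{sPCSP}(A,B)$ is not FNP-hard under generalized many-one reductions (and hence not under many-one reductions either). Consequently, if $\mathrm{sPCSP}(A,B)$ is not solvable in polynomial time, then it is FNP-intermediate. -/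

import Mathlib

/-! Polynomial time, search problems and promise constraint satisfaction. -/

namespace SPCSP

/-! ### The machine model

A machine has stacks of bits, numbered by natural numbers, of which a program uses only finitely
many.  Every instruction touches the top symbol of a single stack and every instruction and every
evaluation of a test costs one step.  (Two stacks make a tape: such machines and multi-tape Turing
machines simulate each other with polynomial overhead.) -/

/-- Programs of the stack machine.  A test `S` is a predicate on what can be seen on top of a stack:
`none` (the stack is empty), `some false` or `some true`. -/
inductive Prog : Type
  | skip : Prog
  | push (r : ℕ) (b : Bool) : Prog
  | pop (r : ℕ) : Prog
  | seq (p q : Prog) : Prog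
  | cond (r : ℕ) (S : Option Bool → Bool) (p q : Prog) : Prog
  | loop (r : ℕ) (S : Option Bool → Bool) (p : Prog) : Prog

/-- The contents of the stacks; the head of a list is the top of the stack. -/
abbrev Mem : Type := ℕ → List Bool

/-- `Exec p m t m'`: started on the memory `m`, the program `p` halts after exactly `t` steps with
the memory `m'`. -/
inductive Exec : Prog → Mem → ℕ → Mem → Prop
  | skip (m : Mem) : Exec Prog.skip m 1 m
  | push (r : ℕ) (b : Bool) (m : Mem) :
      Exec (Prog.push r b) m 1 (Function.update m r (b :: m r))
  | pop (r : ℕ) (m : Mem) :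
      Exec (Prog.pop r) m 1 (Function.update m r (m r).tail)
  | seq {p q : Prog} {m m₁ m₂ : Mem} {t₁ t₂ : ℕ} :
      Exec p m t₁ m₁ → Exec q m₁ t₂ m₂ → Exec (Prog.seq p q) m (t₁ + t₂) m₂
  | cond_true {r : ℕ} {S : Option Bool → Bool} {p q : Prog} {m m' : Mem} {t : ℕ} :
      S (m r).head? = true → Exec p m t m' → Exec (Prog.cond r S p q) m (t + 1) m'
  | cond_false {r : ℕ} {S : Option Bool → Bool} {p q : Prog} {m m' : Mem} {t : ℕ} :
      S (m r).head? = false → Exec q m t m' → Exec (Prog.cond r S p q) m (t + 1) m'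
  | loop_done {r : ℕ} {S : Option Bool → Bool} {p : Prog} {m : Mem} :
      S (m r).head? = false → Exec (Prog.loop r S p) m 1 m
  | loop_step {r : ℕ} {S : Option Bool → Bool} {p : Prog} {m m₁ m₂ : Mem} {t₁ t₂ : ℕ} :
      S (m r).head? = true → Exec p m t₁ m₁ → Exec (Prog.loop r S p) m₁ t₂ m₂ →
        Exec (Prog.loop r S p) m (t₁ + t₂ + 1) m₂

/-- The initial memory: the input strings stand on the stacks `0, 1, …`, all others are empty. -/
def load (inputs : List (List Bool)) : Mem := fun r => inputs.getD r []

/-- `f` is computable in polynomial time, where an argument is presented by a list of strings (one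
per stack), and the value by one string, which is found on stack `0` at the end.  The polynomial
is in the total length of the input strings. -/
def PolyTime {X Y : Type} (encIn : X → List (List Bool)) (encOut : Y → List Bool)
    (f : X → Y) : Prop :=
  ∃ (p : Prog) (q : Polynomial ℕ), ∀ x : X, ∃ (t : ℕ) (m : Mem),
    Exec p (load (encIn x)) t m ∧ t ≤ q.eval ((encIn x).map List.length).sum ∧
      m 0 = encOut (f x)

/-! ### The classes NP, coNP and FNP -/

/-- `R` is recognizable in polynomial time. -/
def PolyRecognizable (R : List Bool → List Bool → Prop) : Prop :=
  ∃ χ : List Bool × List Bool → Bool,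
    PolyTime (fun w => [w.1, w.2]) (fun c => [c]) χ ∧ ∀ x y, χ (x, y) = true ↔ R x y

/-- `R` is polynomially bounded. -/
def PolyBounded (R : List Bool → List Bool → Prop) : Prop :=
  ∃ q : Polynomial ℕ, ∀ x y, R x y → y.length ≤ q.eval x.length

/-- The relations that define the problems in FNP. -/
def FNP : Set (List Bool → List Bool → Prop) :=
  {R | PolyBounded R ∧ PolyRecognizable R}

/-- NP: languages with polynomially bounded certificates that are checked in polynomial time. -/
def NP : Set (Set (List Bool)) :=
  {L | ∃ R ∈ FNP, ∀ x, x ∈ L ↔ ∃ y, R x y}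

/-- coNP: the complements of the languages in NP. -/
def coNP : Set (Set (List Bool)) := {L | Lᶜ ∈ NP}

/-! ### Promise problems, search problems and reductions -/

/-- A decision promise problem. -/
structure PromiseProblem where
  yes : Set (List Bool)
  no : Set (List Bool)

/-- A polynomial-time algorithm accepts all inputs in `yes` and rejects all inputs in `no`. -/
def PromiseProblem.PolyTimeSolvable (P : PromiseProblem) : Prop :=
  ∃ f : List Bool → Bool, PolyTime (fun x => [x]) (fun c => [c]) f ∧
    (∀ x ∈ P.yes, f x = true) ∧ (∀ x ∈ P.no, f x = false)

/-- An answer in a search problem is a string or the reject symbol, which is `none`. -/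
abbrev Answer : Type := Option (List Bool)

/-- How an answer is written on a stack: the reject symbol as the empty string, a string with one
leading bit. -/
def encAnswer : Answer → List Bool
  | none => []
  | some y => true :: y

/-- Correct answers to `x` in the search problem of the relation `R`: some `y` with `R x y`, or the
reject symbol if there is no such `y`. -/
def IsAnswer (R : List Bool → List Bool → Prop) (x : List Bool) : Answer → Prop
  | none => ¬ ∃ y, R x y
  | some y => R x y

/-- A promise search problem: the search problem of `rel`, with inputs promised to lie in
`promise`. -/
structure SearchProblem where
  promise : Set (List Bool)
  rel : List Bool → List Bool → Prop

/-- Valid answers.  Nothing is required on inputs that violate the promise. -/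
def SearchProblem.Valid (P : SearchProblem) (x : List Bool) (z : Answer) : Prop :=
  x ∈ P.promise → IsAnswer P.rel x z

/-- The search problem of a relation, without a promise. -/
def SearchProblem.ofRel (R : List Bool → List Bool → Prop) : SearchProblem where
  promise := Set.univ
  rel := R

/-- A polynomial-time algorithm finds a valid answer to every input. -/
def SearchProblem.PolyTimeSolvable (P : SearchProblem) : Prop :=
  ∃ f : List Bool → Answer, PolyTime (fun x => [x]) encAnswer f ∧ ∀ x, P.Valid x (f x)

/-- Membership in FNP; for a problem with a promise, agreement with an FNP relation on the
promise. -/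
def SearchProblem.InFNP (P : SearchProblem) : Prop :=
  ∃ R ∈ FNP, ∀ x ∈ P.promise, ∀ y, P.rel x y ↔ R x y

/-- Polynomial-time (generalized many-one) reductions: `α` maps inputs of `P` to inputs of `Q`, and
`β` turns every valid answer to `α x`, the reject symbol included, into a valid answer to `x`.
Many-one reductions are those where moreover `β` turns rejections, and only these, into
rejections. -/
def SearchProblem.ReducesTo (P Q : SearchProblem) : Prop :=
  ∃ (α : List Bool → List Bool) (β : List Bool × Answer → Answer),
    PolyTime (fun x => [x]) id α ∧
    PolyTime (fun w => [w.1, encAnswer w.2]) encAnswer β ∧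
    ∀ x z, Q.Valid (α x) z → P.Valid x (β (x, z))

/-- Every problem in FNP reduces to `P`. -/
def SearchProblem.FNPHard (P : SearchProblem) : Prop :=
  ∀ R ∈ FNP, (SearchProblem.ofRel R).ReducesTo P

/-- In FNP, but neither solvable in polynomial time nor FNP-hard. -/
def SearchProblem.FNPIntermediate (P : SearchProblem) : Prop :=
  P.InFNP ∧ ¬ P.PolyTimeSolvable ∧ ¬ P.FNPHard

/-! ### Relational structures and promise constraint satisfaction -/

/-- A finite relational signature; its symbols are numbered. -/
structure Signature where
  numSym : ℕ
  ar : Fin numSym → ℕ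

/-- A structure with universe `U`. -/
def RelStr (σ : Signature) (U : Type*) : Type _ :=
  (i : Fin σ.numSym) → Set (Fin (σ.ar i) → U)

/-- Homomorphisms of structures. -/
def IsHom {σ : Signature} {U V : Type*} (X : RelStr σ U) (Y : RelStr σ V) (h : U → V) : Prop :=
  ∀ (i : Fin σ.numSym) (e : Fin (σ.ar i) → U), e ∈ X i → (fun j => h (e j)) ∈ Y i

/-- There is a homomorphism from `X` to `Y`. -/
def HomTo {σ : Signature} {U V : Type*} (X : RelStr σ U) (Y : RelStr σ V) : Prop :=
  ∃ h : U → V, IsHom X Y h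

/-- A finite input structure: its universe is `{0, …, size - 1}` and its relations are given by the
list of their tuples, each with the number of its symbol. -/
structure Input (σ : Signature) where
  size : ℕ
  facts : List (Σ i : Fin σ.numSym, (Fin (σ.ar i) → Fin size))

/-- The structure that an input presents. -/
def Input.str {σ : Signature} (I : Input σ) : RelStr σ (Fin I.size) :=
  fun i => {e | (⟨i, e⟩ : Σ i : Fin σ.numSym, (Fin (σ.ar i) → Fin I.size)) ∈ I.facts}

/-- The number `k` is written as `k` ones and a zero. -/
def unary (k : ℕ) : List Bool := List.replicate k true ++ [false]

/-- The string that encodes an input: the size of the universe, then the tuples one by one, each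
as the number of its symbol followed by its entries. -/
def Input.code {σ : Signature} (I : Input σ) : List Bool :=
  unary I.size ++ I.facts.flatMap fun f =>
    unary f.1.val ++ (List.ofFn f.2).flatMap fun v => unary v.val

/-- The string that encodes a map from `{0, …, n - 1}` to a finite set whose elements are numbered:
the list of its values. -/
def mapCode {V : Type*} {k n : ℕ} (num : V ≃ Fin k) (h : Fin n → V) : List Bool :=
  (List.ofFn h).flatMap fun v => unary (num v).val

/-- The decision problem PCSP(A, B). -/
def PCSP {σ : Signature} {U V : Type*} (A : RelStr σ U) (B : RelStr σ V) : PromiseProblem where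
  yes := {x | ∃ I : Input σ, x = I.code ∧ HomTo I.str A}
  no := {x | ∃ I : Input σ, x = I.code ∧ ¬ HomTo I.str B}

/-- The search problem sPCSP(A, B): find a homomorphism from `I` to `B`, or reject if there is none,
under the promise that `I` maps to `A` or does not map to `B`. -/
def sPCSP {σ : Signature} {U V : Type*} {k : ℕ} (A : RelStr σ U) (B : RelStr σ V)
    (num : V ≃ Fin k) : SearchProblem where
  promise := {x | ∃ I : Input σ, x = I.code ∧ (HomTo I.str A ∨ ¬ HomTo I.str B)}
  rel := fun x y => ∃ (I : Input σ) (h : Fin I.size → V),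
    x = I.code ∧ y = mapCode num h ∧ IsHom I.str B h

end SPCSP

namespace SPCSP

/-- Started on `m`, the program halts within `T` steps in a memory that satisfies `Q`. -/
def Halts (p : Prog) (m : Mem) (T : ℕ) (Q : Mem → Prop) : Prop :=
  ∃ t m', Exec p m t m' ∧ t ≤ T ∧ Q m'

namespace Halts

variable {p q : Prog} {m : Mem} {T T₁ T₂ : ℕ} {Q Q' : Mem → Prop} {r : ℕ}
  {S : Option Bool → Bool}

theorem mono (h : Halts p m T₁ Q) (hT : T₁ ≤ T₂) (hQ : ∀ m', Q m' → Q' m') :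
    Halts p m T₂ Q' := by
  obtain ⟨t, m', he, ht, hq⟩ := h
  exact ⟨t, m', he, ht.trans hT, hQ _ hq⟩

theorem mono_time (h : Halts p m T₁ Q) (hT : T₁ ≤ T₂) : Halts p m T₂ Q :=
  h.mono hT fun _ => id

theorem skip (h : Q m) : Halts Prog.skip m 1 Q := ⟨1, m, Exec.skip m, le_rfl, h⟩

theorem push {b : Bool} (h : Q (Function.update m r (b :: m r))) :
    Halts (Prog.push r b) m 1 Q := ⟨1, _, Exec.push r b m, le_rfl, h⟩

theorem pop (h : Q (Function.update m r (m r).tail)) :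
    Halts (Prog.pop r) m 1 Q := ⟨1, _, Exec.pop r m, le_rfl, h⟩

theorem seq (h : Halts p m T₁ fun m₁ => Halts q m₁ T₂ Q) :
    Halts (Prog.seq p q) m (T₁ + T₂) Q := by
  obtain ⟨t, m', he, ht, t', m'', he', ht', hq⟩ := h
  exact ⟨_, m'', Exec.seq he he', by omega, hq⟩

theorem cond_true (hS : S (m r).head? = true) (h : Halts p m T Q) :
    Halts (Prog.cond r S p q) m (T + 1) Q := by
  obtain ⟨t, m', he, ht, hq⟩ := h
  exact ⟨_, m', Exec.cond_true hS he, by omega, hq⟩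

theorem cond_false (hS : S (m r).head? = false) (h : Halts q m T Q) :
    Halts (Prog.cond r S p q) m (T + 1) Q := by
  obtain ⟨t, m', he, ht, hq⟩ := h
  exact ⟨_, m', Exec.cond_false hS he, by omega, hq⟩

theorem cond (h₁ : S (m r).head? = true → Halts p m T Q)
    (h₂ : S (m r).head? = false → Halts q m T Q) :
    Halts (Prog.cond r S p q) m (T + 1) Q := by
  cases hS : S (m r).head?
  · exact cond_false hS (h₂ hS)
  · exact cond_true hS (h₁ hS)

theorem loop_done (hS : S (m r).head? = false) (h : Q m) :
    Halts (Prog.loop r S p) m 1 Q := ⟨1, m, Exec.loop_done hS, le_rfl, h⟩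

theorem loop_step (hS : S (m r).head? = true)
    (h : Halts p m T₁ fun m₁ => Halts (Prog.loop r S p) m₁ T₂ Q) :
    Halts (Prog.loop r S p) m (T₁ + T₂ + 1) Q := by
  obtain ⟨t, m', he, ht, t', m'', he', ht', hq⟩ := h
  exact ⟨_, m'', Exec.loop_step hS he he', by omega, hq⟩

end Halts

/-- A run of `t` steps lengthens no stack by more than `t`. -/
theorem Exec.length_le {p : Prog} {m m' : Mem} {t : ℕ} (h : Exec p m t m') (r : ℕ) :
    (m' r).length ≤ (m r).length + t := by
  induction h with
  | skip m => omega
  | push s b m => by_cases hr : r = s <;> simp [hr]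
  | pop s m =>
    by_cases hr : r = s
    · subst hr; simp; omega
    · simp [hr]
  | seq _ _ h₁ h₂ => omega
  | cond_true _ _ h => omega
  | cond_false _ _ h => omega
  | loop_done _ => omega
  | loop_step _ _ _ h₁ h₂ => omega

/-- Renumbering of the stacks of a program. -/
def Prog.rename (ρ : ℕ → ℕ) : Prog → Prog
  | .skip => .skip
  | .push r b => .push (ρ r) b
  | .pop r => .pop (ρ r)
  | .seq p q => .seq (p.rename ρ) (q.rename ρ)
  | .cond r S p q => .cond (ρ r) S (p.rename ρ) (q.rename ρ)
  | .loop r S p => .loop (ρ r) S (p.rename ρ)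

/-- A renumbered program runs as the original one and leaves all other stacks alone. -/
theorem Exec.rename {ρ : ℕ → ℕ} (hρ : Function.Injective ρ) {p : Prog} {m m' : Mem} {t : ℕ}
    (h : Exec p m t m') : ∀ M : Mem, (∀ r, M (ρ r) = m r) →
      ∃ M', Exec (p.rename ρ) M t M' ∧ (∀ r, M' (ρ r) = m' r) ∧
        ∀ s, (∀ r, s ≠ ρ r) → M' s = M s := by
  have upd : ∀ (M m : Mem) (s : ℕ) (l : List Bool), (∀ r, M (ρ r) = m r) →
      ∀ r, Function.update M (ρ s) l (ρ r) = Function.update m s l r := by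
    intro M m s l hM r
    by_cases hr : r = s
    · subst hr; simp
    · simp [hr, hρ.eq_iff, hM]
  induction h with
  | skip m => exact fun M hM => ⟨M, .skip M, hM, fun _ _ => rfl⟩
  | push s b m =>
    refine fun M hM => ⟨_, .push _ b M, ?_, fun u hu => Function.update_of_ne (hu s) _ _⟩
    rw [hM s]; exact upd M m s _ hM
  | pop s m =>
    refine fun M hM => ⟨_, .pop _ M, ?_, fun u hu => Function.update_of_ne (hu s) _ _⟩
    rw [hM s]; exact upd M m s _ hM
  | seq _ _ h₁ h₂ =>
    intro M hM
    obtain ⟨M₁, e₁, a₁, b₁⟩ := h₁ M hM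
    obtain ⟨M₂, e₂, a₂, b₂⟩ := h₂ M₁ a₁
    exact ⟨M₂, .seq e₁ e₂, a₂, fun s hs => (b₂ s hs).trans (b₁ s hs)⟩
  | cond_true hS _ h =>
    intro M hM
    obtain ⟨M₁, e₁, a₁, b₁⟩ := h M hM
    exact ⟨M₁, .cond_true (by rw [hM]; exact hS) e₁, a₁, b₁⟩
  | cond_false hS _ h =>
    intro M hM
    obtain ⟨M₁, e₁, a₁, b₁⟩ := h M hM
    exact ⟨M₁, .cond_false (by rw [hM]; exact hS) e₁, a₁, b₁⟩
  | loop_done hS =>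
    exact fun M hM => ⟨M, .loop_done (by rw [hM]; exact hS), hM, fun _ _ => rfl⟩
  | loop_step hS _ _ h₁ h₂ =>
    intro M hM
    obtain ⟨M₁, e₁, a₁, b₁⟩ := h₁ M hM
    obtain ⟨M₂, e₂, a₂, b₂⟩ := h₂ M₁ a₁
    exact ⟨M₂, .loop_step (by rw [hM]; exact hS) e₁ e₂, a₂,
      fun s hs => (b₂ s hs).trans (b₁ s hs)⟩

/-- Empty a stack. -/
def Prog.clear (r : ℕ) : Prog := .loop r Option.isSome (.pop r)

theorem Halts.clear {r : ℕ} {Q : Mem → Prop} (m : Mem) (h : Q (Function.update m r [])) :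
    Halts (Prog.clear r) m (2 * (m r).length + 1) Q := by
  generalize hl : m r = l
  induction l generalizing m with
  | nil =>
    refine Halts.loop_done (by simp [hl]) ?_
    rwa [← hl, Function.update_eq_self] at h
  | cons b l ih =>
    refine (Halts.loop_step (T₁ := 1) (by simp [hl])
      (Halts.pop (ih _ (by simpa using h) (by simp [hl])))).mono_time ?_
    simp; omega

/-- Move the symbols of the stack `a` one by one to both stacks `b` and `c`. -/
def Prog.pour (a b c : ℕ) : Prog :=
  .loop a Option.isSome (.cond a (· == some true)
    (.seq (.pop a) (.seq (.push b true) (.push c true)))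
    (.seq (.pop a) (.seq (.push b false) (.push c false))))

theorem Halts.pour {a b c : ℕ} (hab : a ≠ b) (hac : a ≠ c) (hbc : b ≠ c) {Q : Mem → Prop}
    (m : Mem)
    (h : Q (Function.update (Function.update (Function.update m a []) b
      ((m a).reverse ++ m b)) c ((m a).reverse ++ m c))) :
    Halts (Prog.pour a b c) m (5 * (m a).length + 1) Q := by
  generalize hl : m a = l at h
  induction l generalizing m with
  | nil =>
    refine Halts.loop_done (by simp [hl]) ?_
    rw [← hl] at h
    convert h using 1
    funext r
    simp only [Function.update_apply]
    split_ifs <;> simp_all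
  | cons d l ih =>
    have step : Halts (.seq (.pop a) (.seq (.push b d) (.push c d))) m 3
        fun m₁ => Halts (Prog.pour a b c) m₁ (5 * l.length + 1) Q := by
      refine Halts.seq (T₁ := 1) (T₂ := 2) (Halts.pop (Halts.seq (T₁ := 1) (T₂ := 1)
        (Halts.push (Halts.push (ih _ ?_ ?_)))))
      · simp [Function.update_apply, hl, hab, hac]
      · convert h using 1
        funext r
        simp only [Function.update_apply]
        split_ifs <;> simp_all
    refine (Halts.loop_step (T₁ := 4) (T₂ := 5 * l.length + 1) (by simp [hl]) ?_).mono_time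
      (by simp; omega)
    cases d
    · exact Halts.cond_false (by simp [hl]) step
    · exact Halts.cond_true (by simp [hl]) step

theorem eval_mono (q : Polynomial ℕ) {a b : ℕ} (h : a ≤ b) : q.eval a ≤ q.eval b := by
  rw [Polynomial.eval_eq_sum_range, Polynomial.eval_eq_sum_range]
  gcongr

/-- Functions of two strings that are computable in polynomial time. -/
def PolyTimeTwo (g : List Bool → List Bool → List Bool) : Prop :=
  ∃ (p : Prog) (q : Polynomial ℕ), ∀ x y,
    Halts p (load [x, y]) (q.eval (x.length + y.length)) fun m => m 0 = g x y

namespace PolyTimeTwo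

theorem of_polyTime_one {Y : Type} {encOut : Y → List Bool}
    {f : List Bool → Y} (h : PolyTime (fun x => [x]) encOut f) :
    PolyTimeTwo fun x _ => encOut (f x) := by
  obtain ⟨p, q, h⟩ := h
  refine ⟨.seq (.clear 1) p, 2 * Polynomial.X + 1 + q, fun x y => ?_⟩
  obtain ⟨t, m, he, ht, hm⟩ := h x
  refine (Halts.seq (T₂ := t) (Halts.clear _ ⟨t, m, ?_, le_rfl, hm⟩)).mono_time ?_
  · convert he using 1
    funext r
    rcases r with _ | _ | r <;> simp [load]
  · have := eval_mono q (show x.length ≤ x.length + y.length by omega)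
    simp at ht
    simp [load]
    omega

theorem of_polyTime_cons {X : Type} {encOut : X → List Bool}
    {f : List Bool × Answer → X} (h : PolyTime (fun w => [w.1, encAnswer w.2]) encOut f) :
    PolyTimeTwo fun x y => encOut (f (x, some y)) := by
  obtain ⟨p, q, h⟩ := h
  refine ⟨.seq (.push 1 true) p, 1 + q.comp (Polynomial.X + 1), fun x y => ?_⟩
  obtain ⟨t, m, he, ht, hm⟩ := h (x, some y)
  refine (Halts.seq (T₂ := t) (Halts.push ⟨t, m, ?_, le_rfl, hm⟩)).mono_time ?_
  · convert he using 1
    funext r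
    rcases r with _ | _ | r <;> simp [load, encAnswer]
  · simpa [encAnswer, add_assoc] using ht

theorem snd : PolyTimeTwo fun _ y => y := by
  refine ⟨.seq (.clear 0) (.seq (.pour 1 2 3) (.pour 2 0 4)), 12 * Polynomial.X + 3,
    fun x y => ?_⟩
  refine (Halts.seq (Halts.clear _ (Halts.seq (Halts.pour (a := 1) (b := 2) (c := 3)
    (by simp) (by simp) (by simp) _
    (Halts.pour (a := 2) (b := 0) (c := 4) (by simp) (by simp) (by simp) _ ?_))))).mono_time ?_
  · simp [load]
  · simp [load]; omega

/-- Put a string on top of a stack. -/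
def _root_.SPCSP.Prog.pushAll (r : ℕ) : List Bool → Prog
  | [] => .skip
  | b :: l => .seq (Prog.pushAll r l) (.push r b)

theorem _root_.SPCSP.Halts.pushAll {r : ℕ} {Q : Mem → Prop} (l : List Bool) (m : Mem)
    (h : Q (Function.update m r (l ++ m r))) : Halts (Prog.pushAll r l) m (l.length + 1) Q := by
  induction l generalizing Q with
  | nil => exact Halts.skip (by simpa using h)
  | cons b l ih =>
    exact Halts.seq (ih (Halts.push (by simpa using h)))

theorem ofHeads (φ : Option Bool → Option Bool → List Bool) :
    PolyTimeTwo fun x y => φ x.head? y.head? := by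
  let leaf (a b : Option Bool) : Prog := .seq (.clear 0) (.pushAll 0 (φ a b))
  let inner (a : Option Bool) : Prog :=
    .cond 1 Option.isNone (leaf a none) (.cond 1 (· == some true) (leaf a (some true))
      (leaf a (some false)))
  let C := (φ none none).length + (φ none (some true)).length + (φ none (some false)).length +
    (φ (some true) none).length + (φ (some true) (some true)).length +
    (φ (some true) (some false)).length + (φ (some false) none).length +
    (φ (some false) (some true)).length + (φ (some false) (some false)).length
  have hC : ∀ a b, (φ a b).length ≤ C := by
    rintro (_ | _ | _) (_ | _ | _) <;> simp only [C] <;> omega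
  refine ⟨.cond 0 Option.isNone (inner none) (.cond 0 (· == some true) (inner (some true))
    (inner (some false))), 2 * Polynomial.X + Polynomial.C (C + 6), fun x y => ?_⟩
  have hleaf : ∀ a b, Halts (leaf a b) (load [x, y]) (2 * x.length + 1 + (C + 1))
      fun m => m 0 = φ a b := fun a b =>
    Halts.seq (Halts.clear _ ((Halts.pushAll _ _ (by simp)).mono_time
      (Nat.succ_le_succ (hC a b))))
  have hinner : ∀ a, Halts (inner a) (load [x, y]) (2 * x.length + 1 + (C + 1) + 1 + 1)
      fun m => m 0 = φ a y.head? := by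
    intro a
    rcases y with _ | ⟨_ | _, y⟩
    · exact (Halts.cond_true (by simp [load]) (hleaf a _)).mono_time (by omega)
    · exact Halts.cond_false (by simp [load])
        (Halts.cond_false (by simp [load]) (hleaf a _))
    · exact Halts.cond_false (by simp [load])
        (Halts.cond_true (by simp [load]) (hleaf a _))
  refine Halts.mono_time (T₁ := 2 * x.length + 1 + (C + 1) + 1 + 1 + 1 + 1) ?_
    (by simp; omega)
  rcases x with _ | ⟨_ | _, x⟩
  · exact (Halts.cond_true (by simp [load]) (hinner _)).mono_time (by omega)
  · exact Halts.cond_false (by simp [load])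
      (Halts.cond_false (by simp [load]) (hinner _))
  · exact Halts.cond_false (by simp [load])
      (Halts.cond_true (by simp [load]) (hinner _))

/-- The length of the value of a polynomial-time function is polynomially bounded. -/
theorem length_le {g : List Bool → List Bool → List Bool} (h : PolyTimeTwo g) :
    ∃ q : Polynomial ℕ, ∀ x y, (g x y).length ≤ q.eval (x.length + y.length) := by
  obtain ⟨p, q, h⟩ := h
  refine ⟨Polynomial.X + q, fun x y => ?_⟩
  obtain ⟨t, m, he, ht, hm⟩ := h x y
  have := he.length_le 0
  rw [hm] at this
  simp [load] at this ⊢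
  omega

theorem halts_rename {p : Prog} {q : ℕ} {c : ℕ} {x y z : List Bool} {T : ℕ} {Q : Mem → Prop}
    (h : Halts p (load [x, y]) q fun m => m 0 = z) (M : Mem)
    (h₀ : M c = x) (h₁ : M (3 + c) = y) (h₂ : ∀ r, M (3 * (r + 2) + c) = []) (hT : q ≤ T)
    (hQ : ∀ M' : Mem, M' c = z → (∀ s, (∀ r, s ≠ 3 * r + c) → M' s = M s) → Q M') :
    Halts (p.rename fun r => 3 * r + c) M T Q := by
  obtain ⟨t, m, he, ht, hm⟩ := h
  obtain ⟨M', e, a, b⟩ := he.rename (ρ := fun r => 3 * r + c)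
    (fun a b hab => by simp at hab; exact hab) M (by
      rintro (_ | _ | r)
      · simpa [load] using h₀
      · simpa [load] using h₁
      · simpa [load] using h₂ r)
  exact ⟨t, M', e, ht.trans hT, hQ M' (by simpa [hm] using a 0) b⟩

theorem comp {g a b : List Bool → List Bool → List Bool} (hg : PolyTimeTwo g)
    (ha : PolyTimeTwo a) (hb : PolyTimeTwo b) : PolyTimeTwo fun x y => g (a x y) (b x y) := by
  obtain ⟨la, hla⟩ := ha.length_le
  obtain ⟨lb, hlb⟩ := hb.length_le
  obtain ⟨lg, hlg⟩ := hg.length_le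
  obtain ⟨pa, qa, ha⟩ := ha
  obtain ⟨pb, qb, hb⟩ := hb
  obtain ⟨pg, qg, hg⟩ := hg
  let distribute : Prog :=
    .seq (.pour 0 2 6) (.seq (.pour 2 7 8) (.seq (.pour 1 3 6) (.pour 3 10 11)))
  let collect : Prog :=
    .seq (.pour 7 4 6) (.seq (.pour 4 9 6) (.seq (.pour 8 5 6) (.pour 5 12 6)))
  let A := pa.rename fun r => 3 * r + 7
  let B := pb.rename fun r => 3 * r + 8
  let G := pg.rename fun r => 3 * r + 9
  refine ⟨.seq distribute (.seq A (.seq B (.seq collect (.seq G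
    (.seq (.pour 9 2 6) (.pour 2 0 6)))))),
    10 * Polynomial.X + 10 + (qa + (qb + (10 * la + 10 * lb + 4 + (qg.comp (la + lb) +
      10 * lg.comp (la + lb) + 2)))), fun x y => ?_⟩
  set N := x.length + y.length with hN
  have h_out : ∀ m : Mem, m 9 = g (a x y) (b x y) → m 0 = [] → m 2 = [] →
      Halts (.seq (.pour 9 2 6) (.pour 2 0 6)) m (10 * (g (a x y) (b x y)).length + 2)
        fun m => m 0 = g (a x y) (b x y) := by
    intro m h9 h0 h2
    refine (Halts.seq (Halts.pour (by simp) (by simp) (by simp) _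
      (Halts.pour (by simp) (by simp) (by simp) _ ?_))).mono_time ?_
    · simp [h0, h2, h9]
    · simp [h2, h9]; omega
  have h_run : ∀ m : Mem, m 9 = a x y → m 12 = b x y → (∀ r, m (3 * (r + 2) + 9) = []) →
      m 0 = [] → m 2 = [] →
      Halts (.seq G (.seq (.pour 9 2 6) (.pour 2 0 6))) m
        (qg.eval ((a x y).length + (b x y).length) + (10 * (g (a x y) (b x y)).length + 2))
        fun m => m 0 = g (a x y) (b x y) := by
    intro m h9 h12 hr h0 h2
    refine Halts.seq (halts_rename (hg (a x y) (b x y)) m h9 h12 hr le_rfl ?_)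
    intro m' h9' hm'
    exact h_out m' h9' ((hm' 0 (by intro r; omega)).trans h0) ((hm' 2 (by intro r; omega)).trans h2)
  have h_collect : ∀ m : Mem, m 7 = a x y → m 8 = b x y →
      (∀ s, s ≠ 6 → (∀ r, s ≠ 3 * r + 7) → (∀ r, s ≠ 3 * r + 8) → m s = []) →
      Halts (.seq collect (.seq G (.seq (.pour 9 2 6) (.pour 2 0 6)))) m
        (10 * (a x y).length + 10 * (b x y).length + 4 +
        (qg.eval ((a x y).length + (b x y).length) + (10 * (g (a x y) (b x y)).length + 2)))
        fun m => m 0 = g (a x y) (b x y) := by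
    intro m h7 h8 hm
    have h0 : m 0 = [] := hm 0 (by omega) (by omega) (by omega)
    have h2 : m 2 = [] := hm 2 (by omega) (by omega) (by omega)
    have h4 : m 4 = [] := hm 4 (by omega) (by omega) (by omega)
    have h5 : m 5 = [] := hm 5 (by omega) (by omega) (by omega)
    have h9 : m 9 = [] := hm 9 (by omega) (by omega) (by omega)
    have h12 : m 12 = [] := hm 12 (by omega) (by omega) (by omega)
    refine Halts.seq ((Halts.seq (Halts.pour (by simp) (by simp) (by simp) _
      (Halts.seq (Halts.pour (by simp) (by simp) (by simp) _ (Halts.seq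
      (Halts.pour (by simp) (by simp) (by simp) _ (Halts.pour (by simp) (by simp) (by simp) _
      (h_run _ ?_ ?_ ?_ ?_ ?_)))))))).mono_time ?_)
    · simp [h4, h7, h9]
    · simp [h5, h8, h12]
    · intro r
      have := hm (3 * (r + 2) + 9) (by omega) (by omega) (by omega)
      simp [this]
    · simp [h0]
    · simp [h2]
    · simp [h4, h5, h7, h8]; omega
  have h_all : Halts (.seq distribute (.seq A (.seq B (.seq collect (.seq G
      (.seq (.pour 9 2 6) (.pour 2 0 6))))))) (load [x, y])
      (10 * N + 10 + (qa.eval N + (qb.eval N +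
        (10 * (a x y).length + 10 * (b x y).length + 4 +
        (qg.eval ((a x y).length + (b x y).length) + (10 * (g (a x y) (b x y)).length + 2))))))
      fun m => m 0 = g (a x y) (b x y) := by
    refine Halts.seq ((Halts.seq (Halts.pour (by simp) (by simp) (by simp) _
      (Halts.seq (Halts.pour (by simp) (by simp) (by simp) _ (Halts.seq
      (Halts.pour (by simp) (by simp) (by simp) _ (Halts.pour (by simp) (by simp) (by simp) _
      (Halts.seq (halts_rename (ha x y) _ ?_ ?_ ?_ le_rfl
        fun m₁ h₁ hm₁ => Halts.seq (halts_rename (hb x y) _ ?_ ?_ ?_ le_rfl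
        fun m₂ h₂ hm₂ => h_collect m₂ ?_ h₂ ?_)))))))))).mono_time ?_)
    · simp [load]
    · simp [load]
    · intro r; simp [load, Function.update_apply]; omega
    · rw [hm₁ _ (by omega)]
      simp [load]
    · rw [hm₁ _ (by omega)]
      simp [load]
    · intro r
      rw [hm₁ _ (by omega)]
      simp [load, Function.update_apply]; omega
    · rw [hm₂ _ (by omega), h₁]
    · intro s h6 hs₁ hs₂
      rw [hm₂ s hs₂, hm₁ s hs₁]
      have := hs₁ 0
      have := hs₁ 1
      have := hs₂ 0
      have := hs₂ 1
      rcases s with _ | _ | s <;> simp [load, Function.update_apply]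
      grind
    · simp [load]; omega
  refine h_all.mono_time ?_
  have h₁ : (a x y).length + (b x y).length ≤ la.eval N + lb.eval N :=
    Nat.add_le_add (hla x y) (hlb x y)
  have h₂ := (hlg (a x y) (b x y)).trans (eval_mono lg h₁)
  have h₃ := eval_mono qg h₁
  have h₄ := hla x y
  have h₅ := hlb x y
  simp only [← hN] at h₄ h₅
  simp
  omega

end PolyTimeTwo
/-! ### Lists of numbers in unary -/

/-- The encoding of a list of numbers. -/
def enc (l : List ℕ) : List Bool := l.flatMap unary

@[simp] theorem enc_nil : enc [] = [] := rfl

@[simp] theorem enc_cons (v : ℕ) (l : List ℕ) : enc (v :: l) = unary v ++ enc l := rfl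

theorem unary_zero : unary 0 = [false] := rfl

theorem unary_succ (v : ℕ) : unary (v + 1) = true :: unary v := rfl

theorem unary_ne_nil (v : ℕ) : unary v ≠ [] := by simp [unary]

@[simp] theorem length_unary (v : ℕ) : (unary v).length = v + 1 := by simp [unary]

theorem unary_append_inj {v v' : ℕ} {r r' : List Bool} (h : unary v ++ r = unary v' ++ r') :
    v = v' ∧ r = r' := by
  induction v generalizing v' with
  | zero =>
    cases v' with
    | zero => simpa [unary_zero] using h
    | succ v' => simp [unary_zero, unary_succ] at h
  | succ v ih =>
    cases v' with
    | zero => simp [unary_zero, unary_succ] at h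
    | succ v' =>
      simp only [unary_succ, List.cons_append, List.cons.injEq, true_and] at h
      have := ih h
      exact ⟨by rw [this.1], this.2⟩

theorem enc_append_inj {l l' : List ℕ} {r r' : List Bool} (hl : l.length = l'.length)
    (h : enc l ++ r = enc l' ++ r') : l = l' ∧ r = r' := by
  induction l generalizing l' with
  | nil =>
    obtain rfl : l' = [] := List.length_eq_zero_iff.mp hl.symm
    simpa using h
  | cons v l ih =>
    cases l' with
    | nil => simp at hl
    | cons v' l' =>
      simp only [enc_cons, List.append_assoc] at h
      obtain ⟨rfl, h'⟩ := unary_append_inj h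
      obtain ⟨rfl, rfl⟩ := ih (by simpa using hl) h'
      exact ⟨rfl, rfl⟩

theorem eq_replicate_true_append (s : List Bool) :
    ∃ v r, s = List.replicate v true ++ r ∧ r.head? ≠ some true := by
  induction s with
  | nil => exact ⟨0, [], by simp⟩
  | cons b s ih =>
    cases b
    · exact ⟨0, false :: s, by simp⟩
    · obtain ⟨v, r, rfl, hr⟩ := ih
      exact ⟨v + 1, r, rfl, hr⟩

theorem replicate_append_false (v : ℕ) (r : List Bool) :
    List.replicate v true ++ false :: r = unary v ++ r := by simp [unary]

theorem replicate_ne_unary_append (v v' : ℕ) (r : List Bool) :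
    List.replicate v true ≠ unary v' ++ r := by
  intro h
  have : false ∈ List.replicate v true := by rw [h]; simp [unary]
  simp at this

/-- Split a number below `K` off a string. -/
def peel : ℕ → List Bool → Option ℕ × List Bool
  | 0, s => (none, s)
  | _ + 1, [] => (none, [])
  | _ + 1, false :: s => (some 0, s)
  | K + 1, true :: s => ((peel K s).1.map Nat.succ, (peel K s).2)

theorem peel_unary {K v : ℕ} (h : v < K) (r : List Bool) : peel K (unary v ++ r) = (some v, r) := by
  induction K generalizing v with
  | zero => omega
  | succ K ih =>
    cases v with
    | zero => rfl
    | succ v => simp [unary_succ, peel, ih (Nat.lt_of_succ_lt_succ h)]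

theorem peel_eq_some {K v : ℕ} {s : List Bool} (h : (peel K s).1 = some v) :
    v < K ∧ s = unary v ++ (peel K s).2 := by
  induction K generalizing v s with
  | zero => simp [peel] at h
  | succ K ih =>
    match s with
    | [] => simp [peel] at h
    | false :: s =>
      obtain rfl : 0 = v := by simpa [peel] using h
      exact ⟨by omega, rfl⟩
    | true :: s =>
      simp only [peel, Option.map_eq_some_iff] at h
      obtain ⟨w, hw, rfl⟩ := h
      obtain ⟨h₁, h₂⟩ := ih hw
      refine ⟨by omega, ?_⟩
      rw [Nat.succ_eq_add_one, unary_succ]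
      simpa [peel] using h₂

theorem peel_eq_none {K : ℕ} {s : List Bool} (h : (peel K s).1 = none) {v : ℕ} (hv : v < K)
    (r : List Bool) : s ≠ unary v ++ r := by
  rintro rfl
  simp [peel_unary hv] at h

theorem length_peel_le (K : ℕ) (s : List Bool) : (peel K s).2.length ≤ s.length := by
  induction K generalizing s with
  | zero => simp [peel]
  | succ K ih =>
    match s with
    | [] => simp [peel]
    | false :: s => simp [peel]
    | true :: s => simpa [peel] using (ih s).trans (Nat.le_succ _)

namespace Prog

/-- Remove a number below `K` from the top of a stack, and continue with the program for it. -/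
def branch (r : ℕ) : ℕ → (Option ℕ → Prog) → Prog
  | 0, c => c none
  | K + 1, c => .cond r Option.isNone (c none) (.cond r (· == some true)
      (.seq (.pop r) (branch r K fun o => c (o.map Nat.succ))) (.seq (.pop r) (c (some 0))))

/-- Put a number on top of a stack. -/
def pushNum (r v : ℕ) : Prog := pushAll r (unary v)

/-- Move a number below `K` from one stack to another. -/
def moveNum (a b K : ℕ) : Prog := branch a K fun o => o.elim .skip (pushNum b)

/-- Read a string of ones on stack `0`, and move as many numbers from stack `2` to stack `3`. -/
def scan (K : ℕ) : Prog := .loop 0 (· == some true) (.seq (.pop 0) (moveNum 2 3 K))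

/-- Move all numbers on stack `3` back to stack `2`. -/
def rewind (K : ℕ) : Prog := .loop 3 Option.isSome (moveNum 3 2 K)

/-- Raise the flag for malformed inputs on stack `4`, and delete the rest of the input. -/
def malformed : Prog := .seq (.push 4 true) (clear 0)

/-- Read a number `v` on stack `0`, and continue with the program for the entry number `v` of the
list on stack `2`. -/
def lookup (K : ℕ) (c : ℕ → Prog) : Prog :=
  .seq (scan K) (.cond 0 Option.isSome (.seq (.pop 0) (branch 2 K fun o => o.elim malformed
    fun j => .seq (pushNum 2 j) (.seq (rewind K) (c j)))) malformed)

/-- Look up `a` numbers. -/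
def lookups (K : ℕ) : ℕ → (List ℕ → Prog) → Prog
  | 0, c => c []
  | a + 1, c => lookup K fun j => lookups K a fun js => c (j :: js)

open Classical in
/-- Read the facts on stack `0`, and raise the flag on stack `5` if the values of one of them, by the
list on stack `2`, are not `ok`. -/
noncomputable def readFacts (K S : ℕ) (ar : ℕ → ℕ) (ok : ℕ → List ℕ → Prop) : Prog :=
  .loop 0 Option.isSome (branch 0 S fun o => o.elim malformed fun i =>
    lookups K (ar i) fun js => if ok i js then .skip else .push 5 true)

/-- Read a string of ones on stack `0`, and move as many numbers below `k` from stack `1` to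
stack `3`; raise the flag on stack `5` if they are not there. -/
def readValues (k : ℕ) : Prog :=
  .loop 0 (· == some true) (.seq (.pop 0) (branch 1 k fun o =>
    o.elim (.seq (.push 5 true) (pushNum 3 0)) (pushNum 3)))

/-- Write the verdict. -/
def verdict : Prog :=
  .cond 4 Option.isSome (.cond 6 Option.isSome (.push 0 false) (.push 0 true))
    (.cond 5 Option.isSome (.push 0 false) (.push 0 true))

/-- Check that stack `1` holds a list of `n` numbers below `k` all of whose values at the facts are
`ok`, where stack `0` holds `n` and the facts; or that stack `1` is empty if stack `0` does not hold
such a string. -/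
noncomputable def checker (k S : ℕ) (ar : ℕ → ℕ) (ok : ℕ → List ℕ → Prop) : Prog :=
  .seq (.cond 1 Option.isSome (.push 6 true) .skip)
    (.seq (.seq (readValues k) (.seq (rewind (k + 1))
      (.cond 0 Option.isSome (.seq (.pop 0) (.seq (.cond 1 Option.isSome (.push 5 true) .skip)
        (readFacts (k + 1) S ar ok))) malformed))) verdict)

end Prog

namespace Halts

theorem branch {r K : ℕ} {c : Option ℕ → Prog} {m : Mem} {T : ℕ} {Q : Mem → Prop}
    (h : Halts (c (peel K (m r)).1) (Function.update m r (peel K (m r)).2) T Q) :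
    Halts (Prog.branch r K c) m (T + 3 * K) Q := by
  induction K generalizing m c with
  | zero => simpa [peel, Prog.branch] using h
  | succ K ih =>
    have : m r = [] ∨ ∃ b s, m r = b :: s := by cases m r <;> simp
    rcases this with hr | ⟨b, s, hr⟩
    · refine (Halts.cond_true (by simp [hr]) (T := T) ?_).mono_time (by omega)
      have : peel (K + 1) (m r) = (none, m r) := by rw [hr]; rfl
      rw [this] at h
      simpa using h
    · cases b
      · refine (Halts.cond_false (by simp [hr]) (Halts.cond_false (by simp [hr]) (Halts.seq
          (T₁ := 1) (T₂ := T) (Halts.pop ?_)))).mono_time (by omega)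
        simpa [hr, peel] using h
      · refine (Halts.cond_false (by simp [hr]) (Halts.cond_true (by simp [hr]) (Halts.seq
          (T₁ := 1) (T₂ := T + 3 * K) (Halts.pop (ih ?_))))).mono_time (by omega)
        simpa [hr, peel] using h

theorem pushNum {r v : ℕ} {m : Mem} {Q : Mem → Prop}
    (h : Q (Function.update m r (unary v ++ m r))) : Halts (Prog.pushNum r v) m (v + 2) Q := by
  exact (Halts.pushAll (unary v) m h).mono_time (by simp)

end Halts

/-- The memory with given contents of the stacks `0`, `2` and `3`. -/
def withLists (m : Mem) (s : List Bool) (l l' : List ℕ) : Mem :=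
  Function.update (Function.update (Function.update m 0 s) 2 (enc l)) 3 (enc l')

theorem update_withLists_zero (m : Mem) (s s' : List Bool) (l l' : List ℕ) :
    Function.update (withLists m s l l') 0 s' = withLists m s' l l' := by
  funext j
  simp only [withLists, Function.update_apply]
  split_ifs <;> simp_all

theorem update_withLists_three (m : Mem) (s : List Bool) (l l' : List ℕ) (v : ℕ) :
    Function.update (withLists m s l l') 3 (unary v ++ withLists m s l l' 3) =
      withLists m s l (v :: l') := by
  funext j
  simp only [withLists, Function.update_apply]
  split_ifs <;> simp_all

theorem update_withLists_of_ne (m : Mem) (s a : List Bool) (l l' : List ℕ) {i : ℕ}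
    (h0 : i ≠ 0) (h2 : i ≠ 2) (h3 : i ≠ 3) :
    Function.update (withLists m s l l') i a = withLists (Function.update m i a) s l l' := by
  rw [withLists, withLists, Function.update_comm h3.symm, Function.update_comm h2.symm,
    Function.update_comm h0.symm]

namespace Halts

variable {K : ℕ} {m : Mem} {Q : Mem → Prop}

theorem moveNum_forward (s : List Bool) (l l' : List ℕ) (hl : ∀ v ∈ l, v < K)
    (h : Q (withLists m s l.tail (l.head?.toList ++ l'))) :
    Halts (Prog.moveNum 2 3 K) (withLists m s l l') (4 * K + 1) Q := by
  cases l with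
  | nil =>
    refine (branch (T := 1) ?_).mono_time (by omega)
    have : peel K [] = (none, []) := by cases K <;> rfl
    simp only [withLists, enc_nil] at h ⊢
    simp [this]
    refine Halts.skip ?_
    convert h using 1
    funext r
    simp only [Function.update_apply]
    split_ifs <;> simp_all
  | cons v l =>
    have hv : v < K := hl v (by simp)
    refine (branch (T := v + 2) ?_).mono_time (by omega)
    have : withLists m s (v :: l) l' 2 = unary v ++ enc l := by simp [withLists]
    rw [this, peel_unary hv]
    refine pushNum ?_
    convert h using 1
    funext r
    simp only [withLists, Function.update_apply]
    split_ifs <;> simp_all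

theorem moveNum_back (s : List Bool) (l l' : List ℕ) (v : ℕ) (hv : v < K)
    (h : Q (withLists m s (v :: l) l')) :
    Halts (Prog.moveNum 3 2 K) (withLists m s l (v :: l')) (4 * K + 1) Q := by
  refine (branch (T := v + 2) ?_).mono_time (by omega)
  have : withLists m s l (v :: l') 3 = unary v ++ enc l' := by simp [withLists]
  rw [this, peel_unary hv]
  refine pushNum ?_
  convert h using 1
  funext r
  simp only [withLists, Function.update_apply]
  split_ifs <;> simp_all

theorem scan (r : List Bool) (hr : r.head? ≠ some true) (v : ℕ) (l l' : List ℕ)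
    (hl : ∀ v ∈ l, v < K)
    (h : Q (withLists m r (l.drop v) ((l.take v).reverse ++ l'))) :
    Halts (Prog.scan K) (withLists m (List.replicate v true ++ r) l l') (v * (4 * K + 3) + 1) Q := by
  induction v generalizing l l' with
  | zero => exact (loop_done (by simpa [withLists] using hr) (by simpa using h)).mono_time (by simp)
  | succ v ih =>
    refine (loop_step (T₁ := 1 + (4 * K + 1)) (T₂ := v * (4 * K + 3) + 1) ?_
      (Halts.seq (Halts.pop ?_))).mono_time (by ring_nf; omega)
    · simp [withLists, List.replicate_succ]
    · have : Function.update (withLists m (List.replicate (v + 1) true ++ r) l l') 0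
          (withLists m (List.replicate (v + 1) true ++ r) l l' 0).tail =
          withLists m (List.replicate v true ++ r) l l' := by
        rw [update_withLists_zero]
        simp [withLists, List.replicate_succ]
      rw [this]
      refine moveNum_forward _ _ _ hl (ih _ _ (fun v hv => hl v (List.mem_of_mem_tail hv)) ?_)
      cases l <;> simpa using h

theorem rewind (s : List Bool) (l l' : List ℕ) (hl' : ∀ v ∈ l', v < K)
    (h : Q (withLists m s (l'.reverse ++ l) [])) :
    Halts (Prog.rewind K) (withLists m s l l') (l'.length * (4 * K + 2) + 1) Q := by
  induction l' generalizing l with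
  | nil => exact (loop_done (by simp [withLists]) (by simpa using h)).mono_time (by simp)
  | cons v l' ih =>
    refine (loop_step (T₁ := 4 * K + 1) (T₂ := l'.length * (4 * K + 2) + 1) ?_
      (moveNum_back _ _ _ _ (hl' v (by simp)) (ih _ (fun w hw => hl' w (by simp [hw]))
        (by simpa using h)))).mono_time (by simp; ring_nf; omega)
    have := unary_ne_nil v
    simp [withLists]
    cases h : unary v <;> simp_all

/-- What a program does on a malformed input. -/
def _root_.SPCSP.Malformed (m m' : Mem) : Prop :=
  m' 0 = [] ∧ m' 4 ≠ [] ∧ m' 6 = m 6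

theorem malformed {m₀ : Mem} (h6 : m 6 = m₀ 6) (h : ∀ m', Malformed m₀ m' → Q m') :
    Halts Prog.malformed m (2 * (m 0).length + 2) Q := by
  refine (Halts.seq (T₁ := 1) (Halts.push (Halts.clear _ (h _ ?_)))).mono_time ?_
  · simp [Malformed, h6]
  · simp; omega

theorem lookup {c : ℕ → Prog} (s : List Bool) (l : List ℕ) (hl : ∀ v ∈ l, v < K) {T : ℕ}
    (h : ∀ (v : ℕ) (hv : v < l.length) (r : List Bool), s = unary v ++ r →
      Halts (c l[v]) (withLists m r l []) T Q)
    (h' : (¬ ∃ v r, v < l.length ∧ s = unary v ++ r) → ∀ m', Malformed m m' → Q m') :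
    Halts (Prog.lookup K c) (withLists m s l []) (T + (8 * K + 10) * (s.length + 1)) Q := by
  obtain ⟨v, r, rfl, hr⟩ := eq_replicate_true_append s
  have hsl : (List.replicate v true ++ r).length = v + r.length := by simp
  rw [hsl]
  refine (Halts.seq (T₁ := v * (4 * K + 3) + 1)
    (T₂ := T + v * (4 * K + 2) + 4 * K + 2 * r.length + 7)
    (scan r hr v l [] hl ?_)).mono_time (by ring_nf; omega)
  rcases r with _ | ⟨b, r⟩
  · refine (cond_false (by simp [withLists]) (malformed (m₀ := m) (by simp [withLists])
      (h' ?_))).mono_time (by simp [withLists])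
    rintro ⟨v', r', -, h⟩
    exact replicate_ne_unary_append v v' r' (by simpa using h)
  · obtain rfl : b = false := by simpa using hr
    rw [replicate_append_false] at h h'
    have pop_eq : Function.update (withLists m (false :: r) (l.drop v) ((l.take v).reverse ++ []))
        0 (withLists m (false :: r) (l.drop v) ((l.take v).reverse ++ []) 0).tail =
        withLists m r (l.drop v) (l.take v).reverse := by
      rw [update_withLists_zero]
      simp [withLists]
    refine (cond_true (T := 1 + (T + v * (4 * K + 2) + K + 2 * r.length + 4 + 3 * K))
      (by simp [withLists]) (Halts.seq (Halts.pop ?_))).mono_time (by simp; omega)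
    rw [pop_eq]
    refine branch ?_
    by_cases hv : v < l.length
    · have e : withLists m r (l.drop v) (l.take v).reverse 2 =
          unary l[v] ++ enc (l.drop (v + 1)) := by
        rw [← enc_cons, ← List.drop_eq_getElem_cons hv]
        simp [withLists]
      have hK := hl l[v] (List.getElem_mem hv)
      rw [e, peel_unary hK]
      have e' : Function.update (Function.update (withLists m r (l.drop v) (l.take v).reverse) 2
          (enc (l.drop (v + 1)))) 2 (unary l[v] ++ enc (l.drop (v + 1))) =
          withLists m r (l.drop v) (l.take v).reverse := by
        rw [← e]; simp
      refine (Halts.seq (T₁ := l[v] + 2) (pushNum (Halts.seq (T₁ := v * (4 * K + 2) + 1) (T₂ := T)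
        ?_))).mono_time (by omega)
      simp only [Function.update_self, e']
      refine (rewind _ _ _ (fun w hw => hl w (List.mem_of_mem_take (List.mem_reverse.mp hw)))
        ?_).mono_time ?_
      · simpa using h v hv r rfl
      · simp [Nat.min_eq_left hv.le]
    · have e : withLists m r (l.drop v) (l.take v).reverse 2 = [] := by
        simp [withLists, List.drop_eq_nil_of_le (not_lt.mp hv)]
      have : peel K [] = (none, []) := by cases K <;> rfl
      rw [e, this]
      refine (malformed (m₀ := m) (by simp [withLists]) (h' ?_)).mono_time ?_
      · rintro ⟨v', r', hv', h⟩
        exact hv ((unary_append_inj h).1 ▸ hv')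
      · simp [withLists]; omega

theorem lookups {c : List ℕ → Prog} (a : ℕ) (s : List Bool) (l : List ℕ) (hl : ∀ v ∈ l, v < K)
    {T N : ℕ} (hN : s.length ≤ N)
    (h : ∀ (vs : List ℕ) (r : List Bool), vs.length = a → (∀ v ∈ vs, v < l.length) →
      s = enc vs ++ r → Halts (c (vs.map (l.getD · 0))) (withLists m r l []) T Q)
    (h' : (¬ ∃ vs r, vs.length = a ∧ (∀ v ∈ vs, v < l.length) ∧ s = enc vs ++ r) →
      ∀ m', Malformed m m' → Q m') :
    Halts (Prog.lookups K a c) (withLists m s l []) (T + a * ((8 * K + 10) * (N + 1))) Q := by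
  induction a generalizing s c with
  | zero => exact (h [] s rfl (by simp) rfl).mono_time (by simp)
  | succ a ih =>
    have hle : (8 * K + 10) * (s.length + 1) ≤ (8 * K + 10) * (N + 1) := by gcongr
    refine (lookup (T := T + a * ((8 * K + 10) * (N + 1))) s l hl ?_ ?_).mono_time
      (by rw [Nat.add_one_mul a]; omega)
    · rintro v hv r rfl
      refine ih r (by simp at hN; omega) ?_ ?_
      · rintro vs r rfl hvs rfl
        have := h (v :: vs) r rfl (by simpa [hv] using hvs) (by simp)
        simpa [hv] using this
      · refine fun hn => h' ?_
        rintro ⟨_ | ⟨v', vs⟩, r', hlen, hvs, hr'⟩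
        · simp at hlen
        · simp only [enc_cons, List.append_assoc] at hr'
          obtain ⟨rfl, rfl⟩ := unary_append_inj hr'
          exact hn ⟨vs, r', by simpa using hlen, fun w hw => hvs w (by simp [hw]), rfl⟩
    · refine fun hn => h' ?_
      rintro ⟨_ | ⟨v, vs⟩, r, hlen, hvs, rfl⟩
      · simp at hlen
      · exact hn ⟨v, enc vs ++ r, hvs v (by simp), by simp⟩

end Halts
/-! ### Strings that encode a number and a list of facts -/

/-- The encoding of a list of facts; a fact is a symbol and a list of elements. -/
def encFacts (fs : List (ℕ × List ℕ)) : List Bool := fs.flatMap fun f => enc (f.1 :: f.2)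

/-- A fact about elements below `n`, where the symbols are the numbers below `S` and have the
arities `ar`. -/
def IsFact (S : ℕ) (ar : ℕ → ℕ) (n : ℕ) (f : ℕ × List ℕ) : Prop :=
  f.1 < S ∧ f.2.length = ar f.1 ∧ ∀ v ∈ f.2, v < n

/-- The string `x` encodes the number `n` and the facts `fs` about elements below `n`. -/
def IsCode (S : ℕ) (ar : ℕ → ℕ) (x : List Bool) (n : ℕ) (fs : List (ℕ × List ℕ)) : Prop :=
  (∀ f ∈ fs, IsFact S ar n f) ∧ x = unary n ++ encFacts fs

/-- The condition tested by `Prog.checker`. -/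
def Accepts (k S : ℕ) (ar : ℕ → ℕ) (ok : ℕ → List ℕ → Prop) (x y : List Bool) : Prop :=
  (∃ n fs l, IsCode S ar x n fs ∧ l.length = n ∧ (∀ v ∈ l, v < k) ∧ y = enc l ∧
    ∀ f ∈ fs, ok f.1 (f.2.map (l.getD · 0))) ∨
  (¬ ∃ n fs, IsCode S ar x n fs) ∧ y = []

section

variable {k K S : ℕ} {ar : ℕ → ℕ} {ok : ℕ → List ℕ → Prop}

@[simp] theorem encFacts_nil : encFacts [] = [] := rfl

@[simp] theorem encFacts_cons (f : ℕ × List ℕ) (fs : List (ℕ × List ℕ)) :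
    encFacts (f :: fs) = unary f.1 ++ (enc f.2 ++ encFacts fs) := by
  simp [encFacts]

theorem fact_append_inj {n : ℕ} {f f' : ℕ × List ℕ} (hf : IsFact S ar n f)
    (hf' : IsFact S ar n f') {r r' : List Bool}
    (h : unary f.1 ++ (enc f.2 ++ r) = unary f'.1 ++ (enc f'.2 ++ r')) : f = f' ∧ r = r' := by
  obtain ⟨h₁, h₂⟩ := unary_append_inj h
  obtain ⟨h₃, h₄⟩ := enc_append_inj (by rw [hf.2.1, hf'.2.1, h₁]) h₂
  exact ⟨Prod.ext h₁ h₃, h₄⟩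

theorem encFacts_inj {n : ℕ} {fs fs' : List (ℕ × List ℕ)} (hfs : ∀ f ∈ fs, IsFact S ar n f)
    (hfs' : ∀ f ∈ fs', IsFact S ar n f) (h : encFacts fs = encFacts fs') : fs = fs' := by
  induction fs generalizing fs' with
  | nil =>
    cases fs' with
    | nil => rfl
    | cons f' fs' => simp [unary_ne_nil] at h
  | cons f fs ih =>
    cases fs' with
    | nil => simp [unary_ne_nil] at h
    | cons f' fs' =>
      simp only [List.mem_cons, forall_eq_or_imp] at hfs hfs'
      rw [encFacts_cons, encFacts_cons] at h
      obtain ⟨rfl, h'⟩ := fact_append_inj hfs.1 hfs'.1 h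
      rw [ih hfs.2 hfs'.2 h']

theorem IsCode.unique {x : List Bool} {n n' : ℕ} {fs fs' : List (ℕ × List ℕ)}
    (h : IsCode S ar x n fs) (h' : IsCode S ar x n' fs') : n = n' ∧ fs = fs' := by
  obtain ⟨rfl, e⟩ := unary_append_inj (h.2.symm.trans h'.2)
  exact ⟨rfl, encFacts_inj h.1 h'.1 e⟩

/-- The result of reading the string `s` with the list of values `l`. -/
def FactsRead (S : ℕ) (ar : ℕ → ℕ) (ok : ℕ → List ℕ → Prop) (l : List ℕ) (m : Mem)
    (s : List Bool) (m' : Mem) : Prop :=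
  m' 0 = [] ∧ m' 6 = m 6 ∧
    ((∃ fs, (∀ f ∈ fs, IsFact S ar l.length f) ∧ s = encFacts fs ∧ m' 4 = [] ∧
      (m' 5 = [] ↔ m 5 = [] ∧ ∀ f ∈ fs, ok f.1 (f.2.map (l.getD · 0)))) ∨
    (¬ ∃ fs, (∀ f ∈ fs, IsFact S ar l.length f) ∧ s = encFacts fs) ∧ m' 4 ≠ [])

theorem Halts.readFacts {A : ℕ} (hA : ∀ i, ar i ≤ A) (l : List ℕ) (hl : ∀ v ∈ l, v < K) (N : ℕ)
    (s : List Bool) (hs : s.length ≤ N) (m : Mem) (h4 : m 4 = []) :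
    Halts (Prog.readFacts K S ar ok) (withLists m s l [])
      (s.length * (3 * S + A * ((8 * K + 10) * (N + 1)) + 2 * N + 4) + 1)
      (FactsRead S ar ok l m s) := by
  set D := (8 * K + 10) * (N + 1) with hD
  set B := 3 * S + A * D + 2 * N + 4 with hB
  induction hn : s.length using Nat.strong_induction_on generalizing s m with
  | _ n ih =>
  subst hn
  have done : ∀ (m' : Mem) (T : ℕ), (¬ ∃ fs, (∀ f ∈ fs, IsFact S ar l.length f) ∧ s = encFacts fs) →
      Malformed m m' → Halts (Prog.readFacts K S ar ok) m' (T + 1) (FactsRead S ar ok l m s) :=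
    fun m' T hn h => (Halts.loop_done (by simp [h.1])
      ⟨h.1, h.2.2, Or.inr ⟨hn, h.2.1⟩⟩).mono_time (by omega)
  by_cases hs0 : s = []
  · subst hs0
    refine (Halts.loop_done (by simp [withLists]) ⟨by simp [withLists], by simp [withLists],
      Or.inl ⟨[], by simp, rfl, by simpa [withLists] using h4, by simp [withLists]⟩⟩).mono_time
      (by omega)
  have hpos : 0 < s.length := List.length_pos_iff.mpr hs0
  obtain ⟨L, hL⟩ : ∃ L, s.length = L + 1 := ⟨s.length - 1, by omega⟩
  refine (Halts.loop_step (T₁ := A * D + 2 * N + 3 + 3 * S) (T₂ := L * B + 1) ?_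
    (Halts.branch ?_)).mono_time (by rw [hL, Nat.add_one_mul L]; omega)
  · obtain ⟨b, s, rfl⟩ := List.exists_cons_of_ne_nil hs0
    simp [withLists]
  have e0 : withLists m s l [] 0 = s := by simp [withLists]
  have e1 : ∀ r, Function.update (withLists m s l []) 0 r = withLists m r l [] :=
    fun r => update_withLists_zero _ _ _ _ _
  rw [e0, e1]
  rcases hp : (peel S s).1 with _ | i
  · refine (Halts.malformed (m₀ := m) (by simp [withLists]) fun m' => done m' _ ?_).mono_time ?_
    · rintro ⟨_ | ⟨f, fs⟩, hfs, h⟩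
      · exact hs0 h
      · rw [encFacts_cons] at h
        exact peel_eq_none hp (hfs f (by simp)).1 _ h
    · have := length_peel_le S s
      simp [withLists]
      omega
  · obtain ⟨hi, hsi⟩ := peel_eq_some hp
    generalize (peel S s).2 = s₁ at hsi
    have hlen : s.length = i + 1 + s₁.length := by simp [hsi]
    have hAi : ar i * D ≤ A * D := Nat.mul_le_mul_right _ (hA i)
    refine (Halts.lookups (T := 1) (N := N) (ar i) s₁ l hl (by omega) ?_ ?_).mono_time
      (by rw [← hD]; omega)
    · intro vs r hvs hvl hs₁
      have hr : r.length ≤ s₁.length := by simp [hs₁]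
      have hf : IsFact S ar l.length (i, vs) := ⟨hi, hvs, hvl⟩
      have step : ∀ m₁ : Mem, m₁ 4 = [] → m₁ 6 = m 6 →
          (m₁ 5 = [] ↔ m 5 = [] ∧ ok i (vs.map (l.getD · 0))) →
          Halts (Prog.readFacts K S ar ok) (withLists m₁ r l []) (L * B + 1)
            (FactsRead S ar ok l m s) := by
        intro m₁ h₄ h₆ h₅
        refine (ih r.length (by omega) r (by omega) m₁ h₄ rfl).mono
          (Nat.succ_le_succ (Nat.mul_le_mul_right _ (by omega))) ?_
        rintro m' ⟨hm0, hm6, hm⟩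
        refine ⟨hm0, hm6.trans h₆, ?_⟩
        rcases hm with ⟨fs, hfs, rfl, hm4, hm5⟩ | ⟨hn, hm4⟩
        · refine Or.inl ⟨(i, vs) :: fs, ?_, by simp [hsi, hs₁], hm4, ?_⟩
          · simpa [hf] using hfs
          · rw [hm5, h₅]
            simp only [List.mem_cons, forall_eq_or_imp, and_assoc]
        · refine Or.inr ⟨?_, hm4⟩
          rintro ⟨_ | ⟨f, fs⟩, hfs, h⟩
          · exact hs0 h
          · rw [encFacts_cons, hsi, hs₁] at h
            exact hn ⟨fs, fun g hg => hfs g (by simp [hg]),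
              (fact_append_inj hf (hfs f (by simp)) h).2⟩
      split_ifs with hok
      · exact Halts.skip (step m h4 rfl (iff_self_and.mpr fun _ => hok))
      · refine Halts.push ?_
        rw [update_withLists_of_ne _ _ _ _ _ (by simp) (by simp) (by simp)]
        exact step _ (by simp [h4]) (by simp) (by
          simp only [hok, and_false, iff_false, Function.update_self]
          exact List.cons_ne_nil _ _)
    · refine fun hn m' => done m' _ ?_
      rintro ⟨_ | ⟨f, fs⟩, hfs, h⟩
      · exact hs0 h
      · rw [encFacts_cons, hsi] at h
        obtain ⟨h₁, h₂⟩ := unary_append_inj h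
        obtain ⟨-, h₃, h₄⟩ := hfs f (by simp)
        exact hn ⟨f.2, _, by rw [h₃, h₁], h₄, h₂⟩

/-- The result of reading `n` numbers below `k` from stack `1`. -/
def ValuesRead (k n : ℕ) (m : Mem) (vals : List ℕ) (m' : Mem) : Prop :=
  vals.length = n ∧ (∀ v ∈ vals, v < k + 1) ∧ m' 4 = m 4 ∧ m' 6 = m 6 ∧
    (m' 5 = [] → m 5 = [] ∧ (∀ v ∈ vals, v < k) ∧ m 1 = enc vals ++ m' 1) ∧
    (m 5 = [] → ∀ vs r, vs.length = n → (∀ v ∈ vs, v < k) → m 1 = enc vs ++ r → m' 5 = [])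

theorem Halts.readValues (n : ℕ) (r : List Bool) (hr : r.head? ≠ some true) (m : Mem)
    (l : List ℕ) : Halts (Prog.readValues k) (withLists m (List.replicate n true ++ r) [] l)
      (n * (4 * k + 5) + 1)
      fun m' => ∃ m₁ vals, m' = withLists m₁ r [] (vals.reverse ++ l) ∧
        ValuesRead k n m vals m₁ := by
  induction n generalizing m l with
  | zero =>
    refine (Halts.loop_done (by simpa [withLists] using hr)
      ⟨m, [], by simp, by simp +contextual [ValuesRead]⟩).mono_time (by simp)
  | succ n ih =>
    refine (Halts.loop_step (T₁ := 1 + (k + 3 + 3 * k)) (T₂ := n * (4 * k + 5) + 1)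
      (by simp [withLists, List.replicate_succ]) (Halts.seq (Halts.pop (Halts.branch ?_)))).mono_time
      (by rw [Nat.add_one_mul n]; omega)
    have e1 : Function.update (withLists m (List.replicate (n + 1) true ++ r) [] l) 0
        (withLists m (List.replicate (n + 1) true ++ r) [] l 0).tail =
        withLists m (List.replicate n true ++ r) [] l := by
      rw [update_withLists_zero]
      simp [withLists, List.replicate_succ]
    have e2 : withLists m (List.replicate n true ++ r) [] l 1 = m 1 := by simp [withLists]
    rw [e1, e2]
    rcases hp : (peel k (m 1)).1 with _ | v
    · refine (Halts.seq (T₁ := 1) (T₂ := 2) (Halts.push (Halts.pushNum ?_))).mono_time (by omega)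
      rw [update_withLists_of_ne _ _ _ _ _ (by simp) (by simp) (by simp),
        update_withLists_of_ne _ _ _ _ _ (by simp) (by simp) (by simp), update_withLists_three]
      refine (ih _ _).mono le_rfl ?_
      · rintro m' ⟨m₁, vals, rfl, h₁, h₂, h₃, h₄, h₅, h₆⟩
        refine ⟨m₁, 0 :: vals, by simp, by simp [h₁], by simpa using h₂, by simpa using h₃,
          by simpa using h₄, fun h => by simpa using (h₅ h).1, ?_⟩
        rintro - (_ | ⟨v, vs⟩) s hvs hvk e
        · simp at hvs
        · exact (peel_eq_none hp (hvk v (by simp)) (enc vs ++ s) (by simpa using e)).elim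
    · obtain ⟨hv, hm⟩ := peel_eq_some hp
      generalize (peel k (m 1)).2 = y at hm
      refine (Halts.pushNum ?_).mono_time (T₁ := v + 2) (by omega)
      rw [update_withLists_of_ne _ _ _ _ _ (by simp) (by simp) (by simp), update_withLists_three]
      refine (ih _ _).mono le_rfl ?_
      · rintro m' ⟨m₁, vals, rfl, h₁, h₂, h₃, h₄, h₅, h₆⟩
        refine ⟨m₁, v :: vals, by simp, by simp [h₁], ?_, by simpa using h₃,
          by simpa using h₄, fun h => ?_, ?_⟩
        · exact List.forall_mem_cons.mpr ⟨by omega, h₂⟩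
        · have := h₅ h
          refine ⟨by simpa using this.1, by simpa [hv] using this.2.1, ?_⟩
          have e := this.2.2
          simp only [Function.update_self] at e
          simp [hm, e]
        · rintro h5 (_ | ⟨v', vs⟩) s hvs hvk e
          · simp at hvs
          · rw [hm, enc_cons, List.append_assoc] at e
            exact h₆ (by simpa using h5) vs s (by simpa using hvs)
              (fun w hw => hvk w (by simp [hw])) (by simpa using (unary_append_inj e).2)

/-- What `Prog.checker` has found out when it comes to the verdict. -/
def Checked (k S : ℕ) (ar : ℕ → ℕ) (ok : ℕ → List ℕ → Prop) (x y : List Bool) (m : Mem) : Prop :=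
  m 0 = [] ∧ (m 6 = [] ↔ y = []) ∧
    ((m 4 = [] ∧ ∃ n fs, IsCode S ar x n fs ∧ (m 5 = [] ↔ ∃ l : List ℕ, l.length = n ∧
      (∀ v ∈ l, v < k) ∧ y = enc l ∧ ∀ f ∈ fs, ok f.1 (f.2.map (l.getD · 0)))) ∨
    (m 4 ≠ [] ∧ ¬ ∃ n fs, IsCode S ar x n fs))

open Classical in
theorem Halts.verdict {x y : List Bool} {m : Mem} (h : Checked k S ar ok x y m) :
    Halts Prog.verdict m 3 fun m' => m' 0 = [decide (Accepts k S ar ok x y)] := by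
  obtain ⟨h0, h6, h⟩ := h
  have hsome : ∀ l : List Bool, l.head?.isSome = true ↔ l ≠ [] := by simp
  have hsome' : ∀ l : List Bool, l.head?.isSome = false ↔ l = [] := by simp
  have hleaf : ∀ b, (b = true ↔ Accepts k S ar ok x y) → Halts (Prog.push 0 b) m 1
      fun m' => m' 0 = [decide (Accepts k S ar ok x y)] := by
    intro b hb
    refine Halts.push ?_
    by_cases hA : Accepts k S ar ok x y <;> simp_all
  rcases h with ⟨h4, n, fs, hcode, h5⟩ | ⟨h4, hn⟩
  · have hacc : Accepts k S ar ok x y ↔ m 5 = [] := by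
      rw [h5]
      constructor
      · rintro (⟨n', fs', l, hc, hl⟩ | ⟨hn, -⟩)
        · obtain ⟨rfl, rfl⟩ := hcode.unique hc
          exact ⟨l, hl⟩
        · exact (hn ⟨n, fs, hcode⟩).elim
      · rintro ⟨l, hl⟩
        exact Or.inl ⟨n, fs, l, hcode, hl⟩
    refine Halts.cond_false (by simp [h4]) (Halts.cond (fun h => hleaf _ ?_) fun h => hleaf _ ?_)
    · simpa [hacc] using (hsome _).mp h
    · simpa [hacc] using (hsome' _).mp h
  · have hacc : Accepts k S ar ok x y ↔ m 6 = [] := by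
      rw [h6]
      constructor
      · rintro (⟨n, fs, l, hc, -⟩ | ⟨-, hy⟩)
        · exact (hn ⟨n, fs, hc⟩).elim
        · exact hy
      · exact fun hy => Or.inr ⟨hn, hy⟩
    refine Halts.cond_true ((hsome _).mpr h4)
      (Halts.cond (fun h => hleaf _ ?_) fun h => hleaf _ ?_)
    · simpa [hacc] using (hsome _).mp h
    · simpa [hacc] using (hsome' _).mp h

open Classical in
theorem polyTimeTwo_accepts {A : ℕ} (hA : ∀ i, ar i ≤ A) :
    PolyTimeTwo fun x y => [decide (Accepts k S ar ok x y)] := by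
  refine ⟨Prog.checker k S ar ok,
    let X : Polynomial ℕ := Polynomial.X
    2 + ((X * (4 * (k : Polynomial ℕ) + 5) + 1 + (X * (4 * (k : Polynomial ℕ) + 6) + 1 +
      (2 * X + 8 + (X * (3 * (S : Polynomial ℕ) + (A : Polynomial ℕ) *
        ((8 * ((k : Polynomial ℕ) + 1) + 10) * (X + 1)) + 2 * X + 4) + 1)))) + 3), fun x y => ?_⟩
  set N := x.length + y.length with hN
  obtain ⟨n, r, hx, hr⟩ := eq_replicate_true_append x
  have hxl : x.length = n + r.length := by simp [hx]
  set BF := N * (3 * S + A * ((8 * (k + 1) + 10) * (N + 1)) + 2 * N + 4) + 1 with hBF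
  have main : ∀ m : Mem, m 1 = y → m 4 = [] → m 5 = [] → (m 6 = [] ↔ y = []) →
      Halts (.seq (.seq (Prog.readValues k) (.seq (Prog.rewind (k + 1))
      (.cond 0 Option.isSome (.seq (.pop 0) (.seq (.cond 1 Option.isSome (.push 5 true) .skip)
        (Prog.readFacts (k + 1) S ar ok))) Prog.malformed))) Prog.verdict) (withLists m x [] [])
      (n * (4 * k + 5) + 1 + (n * (4 * (k + 1) + 2) + 1 + (2 * N + 8 + BF)) + 3)
      fun m' => m' 0 = [decide (Accepts k S ar ok x y)] := by
    intro m h1 h4 h5 h6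
    rw [hx]
    refine Halts.seq ((Halts.seq ((Halts.readValues n r hr m []).mono le_rfl ?_)))
    rintro _ ⟨m₁, vals, rfl, hlen, hK, e4, e6, hF, hF'⟩
    rw [h1, h5] at hF
    rw [h1] at hF'
    refine Halts.seq ((Halts.rewind (K := k + 1) _ _ _ (by simpa using hK) ?_).mono_time
      (by simp [hlen]))
    simp only [List.append_nil, List.reverse_reverse]
    rw [← hx]
    rcases r with _ | ⟨b, s⟩
    · refine (Halts.cond_false (by simp [withLists]) (Halts.malformed (m₀ := m₁)
        (by simp [withLists]) fun m' hm' => ?_)).mono_time (by simp [withLists]; omega)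
      refine Halts.verdict ⟨hm'.1, ?_, Or.inr ⟨hm'.2.1, ?_⟩⟩
      · rw [hm'.2.2, e6, h6]
      · rintro ⟨n', fs, -, h⟩
        rw [hx, List.append_nil] at h
        exact replicate_ne_unary_append _ _ _ h
    · obtain rfl : b = false := by simpa using hr
      rw [replicate_append_false] at hx
      refine (Halts.cond_true (T := 1 + (2 + BF)) (by simp [withLists]) (Halts.seq (Halts.pop
        (Halts.seq (T₁ := 2) (T₂ := BF) ?_)))).mono_time (by omega)
      have e1 : Function.update (withLists m₁ (false :: s) vals []) 0
          (withLists m₁ (false :: s) vals [] 0).tail = withLists m₁ s vals [] := by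
        rw [update_withLists_zero]
        simp [withLists]
      rw [e1]
      have cont : ∀ m₂ : Mem, m₂ 4 = [] → m₂ 6 = m 6 → (m₂ 5 = [] ↔ m₁ 5 = [] ∧ m₁ 1 = []) →
          Halts (Prog.readFacts (k + 1) S ar ok) (withLists m₂ s vals []) BF
            fun m' => Halts Prog.verdict m' 3
              fun m' => m' 0 = [decide (Accepts k S ar ok x y)] := by
        intro m₂ h₄ h₆ h₅
        have hsN : s.length ≤ N := by simp at hxl; omega
        refine (Halts.readFacts hA vals hK N s hsN m₂ h₄).mono
          (Nat.succ_le_succ (Nat.mul_le_mul_right _ hsN)) fun m' hm' => Halts.verdict ?_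
        obtain ⟨hm0, hm6, hm⟩ := hm'
        refine ⟨hm0, by rw [hm6, h₆, h6], ?_⟩
        rcases hm with ⟨fs, hfs, hs, hm4, hm5⟩ | ⟨hn, hm4⟩
        · refine Or.inl ⟨hm4, n, fs, ⟨hlen ▸ hfs, by rw [hx, hs]⟩, ?_⟩
          rw [hm5, h₅]
          constructor
          · rintro ⟨⟨h5', h1'⟩, hok⟩
            obtain ⟨-, hk, hy⟩ := hF h5'
            exact ⟨vals, hlen, hk, by simpa [h1'] using hy, hok⟩
          · rintro ⟨l, hl, hk, hy, hok⟩
            have h5' := hF' h5 l [] hl hk (by simpa using hy)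
            obtain ⟨-, -, hy'⟩ := hF h5'
            obtain ⟨rfl, h1'⟩ := enc_append_inj (l := l) (r := []) (hl.trans hlen.symm)
              (by rw [List.append_nil, ← hy, hy'])
            exact ⟨⟨h5', h1'.symm⟩, hok⟩
        · refine Or.inr ⟨hm4, ?_⟩
          rintro ⟨n', fs, hfs, h⟩
          rw [hx] at h
          obtain ⟨rfl, h'⟩ := unary_append_inj h
          exact hn ⟨fs, hlen.symm ▸ hfs, h'⟩
      refine Halts.cond (T := 1) (fun h => Halts.push ?_) fun h => Halts.skip ?_
      · rw [update_withLists_of_ne _ _ _ _ _ (by simp) (by simp) (by simp)]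
        refine cont _ (by simp [e4, h4]) (by simp [e6]) ?_
        have : m₁ 1 ≠ [] := by simpa [withLists] using h
        simp [this]
      · refine cont _ (by simp [e4, h4]) e6 ?_
        have : m₁ 1 = [] := by simpa [withLists] using h
        simp [this]
  have hload : load [x, y] = withLists (load [x, y]) x [] [] := by
    funext j
    simp only [withLists, Function.update_apply]
    split_ifs <;> simp_all [load]
  have hnN : n ≤ N := by omega
  have g₁ := Nat.mul_le_mul_right (4 * k + 5) hnN
  have g₂ := Nat.mul_le_mul_right (4 * k + 6) hnN
  refine (Halts.seq (T₁ := 2) (Halts.cond (T := 1) (fun h => Halts.push ?_)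
    fun h => Halts.skip ?_)).mono_time (T₁ := 2 + (n * (4 * k + 5) + 1 +
      (n * (4 * (k + 1) + 2) + 1 + (2 * N + 8 + BF)) + 3)) ?_
  · rw [hload, update_withLists_of_ne _ _ _ _ _ (by simp) (by simp) (by simp)]
    refine main _ (by simp [load]) (by simp [load]) (by simp [load]) ?_
    have : y ≠ [] := by simpa [load] using h
    simp [this]
  · rw [hload]
    refine main _ (by simp [load]) (by simp [load]) (by simp [load]) ?_
    have : y = [] := by simpa [load] using h
    simp [this, load]
  · have g₃ : n * (4 * (k + 1) + 2) = n * (4 * k + 6) := by ring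
    rw [g₃]
    simp
    rw [← hBF]
    omega

end
/-! ### The relation of a search PCSP -/

section

variable {σ : Signature}

/-- The arities of a signature, extended by zero. -/
def Signature.arity (σ : Signature) (i : ℕ) : ℕ := if h : i < σ.numSym then σ.ar ⟨i, h⟩ else 0

/-- A tuple of an input as a symbol and a list of elements. -/
def factOf {n : ℕ} (f : Σ i : Fin σ.numSym, (Fin (σ.ar i) → Fin n)) : ℕ × List ℕ :=
  (f.1.val, List.ofFn fun j => (f.2 j).val)

theorem Input.code_eq (I : Input σ) :
    I.code = unary I.size ++ encFacts (I.facts.map factOf) := by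
  have h : ∀ {a : ℕ} (e : Fin a → Fin I.size),
      ((List.ofFn e).flatMap fun v => unary v.val) = enc (List.ofFn fun j => (e j).val) := by
    intro a e
    rw [enc, show (fun j => (e j).val) = Fin.val ∘ e from rfl, ← List.map_ofFn, List.flatMap_map]
  simp [Input.code, encFacts, factOf, h, List.flatMap_map]

theorem isFact_factOf {n : ℕ} (f : Σ i : Fin σ.numSym, (Fin (σ.ar i) → Fin n)) :
    IsFact σ.numSym σ.arity n (factOf f) := by
  refine ⟨f.1.isLt, by simp [factOf, Signature.arity], fun v hv => ?_⟩
  obtain ⟨j, rfl⟩ := (List.mem_ofFn' _ _).mp hv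
  exact (f.2 j).isLt

theorem exists_factOf_eq {n : ℕ} {f : ℕ × List ℕ} (hf : IsFact σ.numSym σ.arity n f) :
    ∃ g : Σ i : Fin σ.numSym, (Fin (σ.ar i) → Fin n), factOf g = f := by
  obtain ⟨i, vs⟩ := f
  obtain ⟨hi, hlen, hvs⟩ := hf
  have hlen : vs.length = σ.ar ⟨i, hi⟩ := by simpa [Signature.arity, hi] using hlen
  refine ⟨⟨⟨i, hi⟩, fun j => ⟨vs[j.val]'(by omega), hvs _ (List.getElem_mem _)⟩⟩, ?_⟩
  refine Prod.ext rfl (List.ext_getElem (by simp [factOf, hlen]) fun j _ _ => by simp [factOf])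

theorem isCode_iff {x : List Bool} {n : ℕ} {fs : List (ℕ × List ℕ)} :
    IsCode σ.numSym σ.arity x n fs ↔
      ∃ I : Input σ, x = I.code ∧ I.size = n ∧ I.facts.map factOf = fs := by
  constructor
  · rintro ⟨hfs, rfl⟩
    obtain ⟨gs, rfl⟩ : fs ∈ Set.range (List.map (factOf (σ := σ) (n := n))) := by
      rw [Set.range_list_map]
      exact fun f hf => exists_factOf_eq (hfs f hf)
    exact ⟨⟨n, gs⟩, (Input.code_eq ⟨n, gs⟩).symm, rfl, rfl⟩
  · rintro ⟨I, rfl, rfl, rfl⟩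
    refine ⟨fun f hf => ?_, I.code_eq⟩
    obtain ⟨g, -, rfl⟩ := List.mem_map.mp hf
    exact isFact_factOf g

theorem factOf_injective {n : ℕ} : Function.Injective (factOf (σ := σ) (n := n)) := by
  rintro ⟨i, e⟩ ⟨i', e'⟩ h
  obtain ⟨hi, he⟩ := Prod.ext_iff.mp h
  obtain rfl : i = i' := Fin.ext hi
  obtain rfl : e = e' := funext fun j => Fin.ext (congrFun (List.ofFn_injective he) j)
  rfl

theorem Input.code_injective : Function.Injective (Input.code (σ := σ)) := by
  rintro ⟨n, fs⟩ ⟨n', fs'⟩ h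
  obtain ⟨hn, hfs⟩ := (isCode_iff.mpr ⟨⟨n, fs⟩, rfl, rfl, rfl⟩).unique
    (isCode_iff.mpr ⟨⟨n', fs'⟩, h, rfl, rfl⟩)
  obtain rfl : n = n' := hn
  obtain rfl : fs = fs' := factOf_injective.list_map hfs
  rfl

variable {V : Type*} {k : ℕ} (num : V ≃ Fin k) (B : RelStr σ V)

/-- The tuples of a structure as lists of numbers. -/
def IsTuple (i : ℕ) (js : List ℕ) : Prop :=
  ∃ (hi : i < σ.numSym) (e : Fin (σ.ar ⟨i, hi⟩) → V),
    e ∈ B ⟨i, hi⟩ ∧ js = List.ofFn fun j => (num (e j)).val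

/-- The values of a map as a list of numbers. -/
def valuesOf {n : ℕ} (h : Fin n → V) : List ℕ := List.ofFn fun v => (num (h v)).val

theorem mapCode_eq {n : ℕ} (h : Fin n → V) : mapCode num h = enc (valuesOf num h) := by
  rw [mapCode, enc, valuesOf, show (fun v => (num (h v)).val) = (fun v => (num v).val) ∘ h from rfl,
    ← List.map_ofFn, List.flatMap_map]

theorem exists_valuesOf_eq {l : List ℕ} {n : ℕ} (hl : l.length = n) (hk : ∀ v ∈ l, v < k) :
    ∃ h : Fin n → V, valuesOf num h = l := by
  subst hl
  refine ⟨fun v => num.symm ⟨l[v], hk _ (List.getElem_mem _)⟩, ?_⟩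
  exact List.ext_getElem (by simp [valuesOf]) fun j _ _ => by simp [valuesOf]

theorem isTuple_factOf_iff {n : ℕ} (h : Fin n → V)
    (f : Σ i : Fin σ.numSym, (Fin (σ.ar i) → Fin n)) :
    IsTuple num B (factOf f).1 ((factOf f).2.map ((valuesOf num h).getD · 0)) ↔
      (fun j => h (f.2 j)) ∈ B f.1 := by
  have e : (factOf f).2.map ((valuesOf num h).getD · 0) =
      List.ofFn fun j => (num (h (f.2 j))).val := by
    refine List.ext_getElem (by simp [factOf]) fun j _ _ => by simp [factOf, valuesOf]
  rw [e]
  constructor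
  · rintro ⟨hi, t, ht, he⟩
    have : (fun j => h (f.2 j)) = t :=
      funext fun j => num.injective (Fin.ext (congrFun (List.ofFn_injective he) j))
    exact this ▸ ht
  · exact fun ht => ⟨f.1.isLt, _, ht, rfl⟩

theorem isHom_iff (I : Input σ) (h : Fin I.size → V) :
    IsHom I.str B h ↔ ∀ f ∈ I.facts.map factOf,
      IsTuple num B f.1 (f.2.map ((valuesOf num h).getD · 0)) := by
  simp only [List.mem_map, forall_exists_index, and_imp, forall_apply_eq_imp_iff₂,
    isTuple_factOf_iff]
  exact ⟨fun H f hf => H f.1 f.2 hf, fun H i e he => H ⟨i, e⟩ he⟩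

theorem accepts_iff {x y : List Bool} :
    Accepts k σ.numSym σ.arity (IsTuple num B) x y ↔
      (∃ (I : Input σ) (h : Fin I.size → V), x = I.code ∧ y = mapCode num h ∧ IsHom I.str B h) ∨
      (¬ ∃ I : Input σ, x = I.code) ∧ y = [] := by
  refine or_congr ?_ (and_congr_left' (not_congr ?_))
  · constructor
    · rintro ⟨n, fs, l, hc, hl, hk, rfl, hok⟩
      obtain ⟨I, rfl, rfl, rfl⟩ := isCode_iff.mp hc
      obtain ⟨h, rfl⟩ := exists_valuesOf_eq num hl hk
      exact ⟨I, h, rfl, (mapCode_eq num h).symm, (isHom_iff num B I h).mpr hok⟩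
    · rintro ⟨I, h, rfl, rfl, hh⟩
      refine ⟨_, _, valuesOf num h, isCode_iff.mpr ⟨I, rfl, rfl, rfl⟩, by simp [valuesOf], ?_,
        mapCode_eq num h, (isHom_iff num B I h).mp hh⟩
      intro v hv
      obtain ⟨j, rfl⟩ := (List.mem_ofFn' _ _).mp hv
      exact (num (h j)).isLt
  · constructor
    · rintro ⟨n, fs, hc⟩
      obtain ⟨I, hI, -⟩ := isCode_iff.mp hc
      exact ⟨I, hI⟩
    · rintro ⟨I, hI⟩
      exact ⟨_, _, isCode_iff.mpr ⟨I, hI, rfl, rfl⟩⟩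

end

theorem length_enc_le {k : ℕ} {l : List ℕ} (hl : ∀ v ∈ l, v < k) :
    (enc l).length ≤ k * l.length := by
  induction l with
  | nil => simp
  | cons v l ih =>
    have h₁ := ih fun w hw => hl w (by simp [hw])
    have h₂ := hl v (by simp)
    simp only [enc_cons, List.length_append, length_unary, List.length_cons, Nat.mul_add_one]
    omega

theorem Accepts.length_le {k S : ℕ} {ar : ℕ → ℕ} {ok : ℕ → List ℕ → Prop} {x y : List Bool}
    (h : Accepts k S ar ok x y) : y.length ≤ k * x.length := by
  rcases h with ⟨n, fs, l, ⟨-, rfl⟩, rfl, hk, rfl, -⟩ | ⟨-, rfl⟩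
  · refine (length_enc_le hk).trans (Nat.mul_le_mul_left _ ?_)
    simp
    omega
  · simp

open Classical in
theorem polyRecognizable_of_polyTimeTwo {R : List Bool → List Bool → Prop}
    (h : PolyTimeTwo fun x y => [decide (R x y)]) : PolyRecognizable R := by
  obtain ⟨p, q, h⟩ := h
  refine ⟨fun w => decide (R w.1 w.2), ⟨p, q, fun w => ?_⟩, by simp⟩
  obtain ⟨t, m, he, ht, hm⟩ := h w.1 w.2
  exact ⟨t, m, he, by simpa using ht, hm⟩

theorem Signature.exists_arity_le (σ : Signature) : ∃ A, ∀ i, σ.arity i ≤ A := by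
  refine ⟨∑ i, σ.ar i, fun i => ?_⟩
  unfold Signature.arity
  split_ifs with h
  · exact Finset.single_le_sum (f := σ.ar) (fun _ _ => Nat.zero_le _) (Finset.mem_univ _)
  · exact Nat.zero_le _

theorem sPCSP_inFNP {σ : Signature} {U V : Type*} {k : ℕ} (num : V ≃ Fin k) (A : RelStr σ U)
    (B : RelStr σ V) : (sPCSP A B num).InFNP := by
  classical
  obtain ⟨C, hC⟩ := σ.exists_arity_le
  refine ⟨Accepts k σ.numSym σ.arity (IsTuple num B), ⟨⟨(k : Polynomial ℕ) * Polynomial.X,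
    fun x y h => by simpa using h.length_le⟩,
    polyRecognizable_of_polyTimeTwo (by convert polyTimeTwo_accepts hC)⟩, ?_⟩
  rintro x ⟨I, hI, -⟩ y
  rw [accepts_iff, or_iff_left fun h => h.1 ⟨I, hI⟩]
  rfl

/-- If the decision PCSP is solvable in polynomial time, and a problem in FNP reduces to the search
PCSP, then the inputs without a solution form a language in NP. -/
theorem compl_mem_NP_of_reducesTo {σ : Signature} {U V : Type*} {k : ℕ} (num : V ≃ Fin k)
    (A : RelStr σ U) (B : RelStr σ V) (hP : (PCSP A B).PolyTimeSolvable)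
    {R : List Bool → List Bool → Prop}
    (hR : (SearchProblem.ofRel R).ReducesTo (sPCSP A B num)) {L : Set (List Bool)}
    (hL : ∀ x, x ∈ L ↔ ∃ y, R x y) : Lᶜ ∈ NP := by
  classical
  obtain ⟨f, hf, hyes, hno⟩ := hP
  obtain ⟨α, β, hα, hβ, hred⟩ := hR
  obtain ⟨C, hC⟩ := σ.exists_arity_le
  set W := Accepts k σ.numSym σ.arity (IsTuple num B) with hWdef
  have hW : PolyTimeTwo fun x y => [decide (W x y)] := by convert polyTimeTwo_accepts hC
  have none_valid : ∀ x, f x = false → (sPCSP A B num).Valid x none := by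
    rintro x hx ⟨I, rfl, hI⟩ ⟨y, J, h, hJ, -, hh⟩
    rcases hI with hI | hI
    · simp [hyes _ ⟨I, rfl, hI⟩] at hx
    · obtain rfl := Input.code_injective hJ
      exact hI ⟨h, hh⟩
  have some_valid : ∀ x y, W x y → (sPCSP A B num).Valid x (some y) := by
    rintro x y hxy ⟨I, hI, -⟩
    exact ((accepts_iff num B).mp hxy).resolve_right fun h => h.1 ⟨I, hI⟩
  have exists_accepts : ∀ x, f x = true → ∃ y, W x y := by
    intro x hx
    simp only [hWdef, accepts_iff]
    by_cases h : ∃ I : Input σ, x = I.code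
    · obtain ⟨I, rfl⟩ := h
      by_cases hI : HomTo I.str B
      · obtain ⟨g, hg⟩ := hI
        exact ⟨_, Or.inl ⟨I, g, rfl, rfl, hg⟩⟩
      · simp [hno _ ⟨I, rfl, hI⟩] at hx
    · exact ⟨[], Or.inr ⟨h, rfl⟩⟩
  have sound : ∀ x z, (sPCSP A B num).Valid (α x) z → β (x, z) = none → x ∉ L := by
    intro x z hz hβz
    have := hred x z hz trivial
    rw [hβz] at this
    exact fun hx => this ((hL x).mp hx)
  have complete : ∀ x z, (sPCSP A B num).Valid (α x) z → x ∉ L → β (x, z) = none := by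
    intro x z hz hx
    have := hred x z hz trivial
    rcases h : β (x, z) with _ | y
    · rfl
    · rw [h] at this
      exact (hx ((hL x).mpr ⟨y, this⟩)).elim
  let R' : List Bool → List Bool → Prop := fun x w =>
    ((f (α x) = false ∧ w = []) ∧ β (x, none) = none) ∨
      ((f (α x) = true ∧ W (α x) w) ∧ β (x, some w) = none)
  have pα : PolyTimeTwo fun x _ => α x := PolyTimeTwo.of_polyTime_one hα
  have pf : PolyTimeTwo fun x _ => [f (α x)] := (PolyTimeTwo.of_polyTime_one hf).comp pα pα
  have pW : PolyTimeTwo fun x w => [decide (W (α x) w)] := hW.comp pα .snd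
  have pβ : PolyTimeTwo fun x _ => encAnswer (β (x, none)) := by
    refine PolyTimeTwo.of_polyTime_one (f := fun x => β (x, none)) ?_
    obtain ⟨p, q, h⟩ := hβ
    refine ⟨p, q, fun x => ?_⟩
    obtain ⟨t, m, he, ht, hm⟩ := h (x, none)
    refine ⟨t, m, ?_, by simpa [encAnswer] using ht, hm⟩
    convert he using 1
    funext r
    rcases r with _ | _ | r <;> simp [load, encAnswer]
  have pβ' : PolyTimeTwo fun x w => encAnswer (β (x, some w)) := .of_polyTime_cons hβ
  have pR' : PolyTimeTwo fun x w => [decide (R' x w)] := by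
    have p₁ := (PolyTimeTwo.ofHeads fun a b => [a == some false && b.isNone]).comp pf .snd
    have p₂ := (PolyTimeTwo.ofHeads fun a b => [a == some true && b.isNone]).comp p₁ pβ
    have p₃ := (PolyTimeTwo.ofHeads fun a b => [a == some true && b == some true]).comp pf pW
    have p₄ := (PolyTimeTwo.ofHeads fun a b => [a == some true && b.isNone]).comp p₃ pβ'
    have p₅ := (PolyTimeTwo.ofHeads fun a b => [a == some true || b == some true]).comp p₂ p₄
    have none_iff : ∀ z : Answer, (encAnswer z).head?.isNone = true ↔ z = none := by
      rintro (_ | z) <;> simp [encAnswer]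
    convert p₅ using 4
    rw [Bool.eq_iff_iff]
    simp [R', ← none_iff]
  obtain ⟨q, hq⟩ := pα.length_le
  refine ⟨R', ⟨⟨(k : Polynomial ℕ) * q, ?_⟩, polyRecognizable_of_polyTimeTwo (by convert pR')⟩, fun x => ?_⟩
  · rintro x w (⟨⟨-, rfl⟩, -⟩ | ⟨⟨-, h⟩, -⟩)
    · simp
    · refine h.length_le.trans ?_
      simpa using Nat.mul_le_mul_left k (hq x [])
  · constructor
    · intro hx
      cases hfx : f (α x)
      · exact ⟨[], Or.inl ⟨⟨hfx, rfl⟩, complete x _ (none_valid _ hfx) hx⟩⟩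
      · obtain ⟨y, hy⟩ := exists_accepts _ hfx
        exact ⟨y, Or.inr ⟨⟨hfx, hy⟩, complete x _ (some_valid _ _ hy) hx⟩⟩
    · rintro ⟨w, ⟨⟨hfx, -⟩, h⟩ | ⟨⟨-, hw⟩, h⟩⟩
      · exact sound x _ (none_valid _ hfx) h
      · exact sound x _ (some_valid _ _ hw) h

end SPCSP

/-- Let `(A, B)` be a finite template whose decision PCSP is solvable in polynomial time, and
suppose NP ≠ coNP.  Then sPCSP(A, B) is not FNP-hard; hence it is FNP-intermediate if it is not
solvable in polynomial time.  Here `num` is the numbering of the universe of `B` with which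
homomorphisms to `B` are written down. -/
theorem mainTheorem12 {σ : SPCSP.Signature} {U V : Type*} [Finite U] {k : ℕ}
    (num : V ≃ Fin k) (A : SPCSP.RelStr σ U) (B : SPCSP.RelStr σ V)
    (hAB : SPCSP.HomTo A B)
    (hP : (SPCSP.PCSP A B).PolyTimeSolvable)
    (hNP : SPCSP.NP ≠ SPCSP.coNP) :
    ¬ (SPCSP.sPCSP A B num).FNPHard ∧
      (¬ (SPCSP.sPCSP A B num).PolyTimeSolvable → (SPCSP.sPCSP A B num).FNPIntermediate) := by
  have not_hard : ¬ (SPCSP.sPCSP A B num).FNPHard := by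
    intro hard
    have compl_mem : ∀ L ∈ SPCSP.NP, Lᶜ ∈ SPCSP.NP := by
      rintro L ⟨R, hR, hL⟩
      exact SPCSP.compl_mem_NP_of_reducesTo num A B hP (hard R hR) hL
    refine hNP (Set.ext fun L => ⟨compl_mem L, fun hL => ?_⟩)
    simpa using compl_mem _ hL
  exact ⟨not_hard, fun h => ⟨SPCSP.sPCSP_inFNP num A B, h, not_hard⟩⟩
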